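/- Let $n\ge 1$. Let $\mathcal P^n$ and $\mathcal R^n$ be the polynomials and the rational functions on $\mathbb C^n$, and let $\mathcal M_0^n$ be the algebra of meromorphic functions on $\mathbb C^n$ of the form $h/q$ with $h$ entire and $q\in\mathcal P^n$, $q\not\equiv 0$. An entire function $f$ on $\mathbb C^n$ is transcendental if it is not algebraic over $\mathcal P^n$ (equivalently, $f\notin\mathcal P^n$). It has finite order if there is $\rho\ge 0$ such that for every $\rho'>\rho$ there is a constant $C$ with $|f(z)|\le C e^{|z|^{\rho'}}$ for all $z\in\mathbb C^n$. Theorem. Let $f$ be a transcendental entire function of finite order on $\mathbb C^n$. Let $P\in\mathcal R^n[w]$ be a polynomial in one variable $w$ with coefficients in $\mathcal R^n$, let $R\in\mathcal R^n$ with $R\not\equiv 0$, and let $p$ be a non-constant entire function on $\mathbb C^n$, such that $P(f)=R\,e^{p}$ in $\mathcal M_0^n$. Then $p$ is a polynomial, $\deg p\ge 1$, and there exist an integer $m\ge 1$ and rational functions $p_1,p_2\in\mathcal R^n$, $p_2\not\equiv 0$, such that $$P(w)=R\,p_2^{m}\,(w+p_1)^{m}\ \text{ in } \mathcal R^n[w],\qquad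 f=p_2^{-1}e^{p/m}-p_1 .$$ -/

import Mathlib

/-- The algebra of entire functions on `ℂⁿ`, with pointwise operations. -/
def Entire (n : ℕ) : Subalgebra ℂ ((Fin n → ℂ) → ℂ) where
  carrier := {f | Differentiable ℂ f}
  mul_mem' {f g} (hf : Differentiable ℂ f) (hg : Differentiable ℂ g) := hf.mul hg
  add_mem' {f g} (hf : Differentiable ℂ f) (hg : Differentiable ℂ g) := hf.add hg
  algebraMap_mem' c := differentiable_const c

namespace Entire

variable {n : ℕ}

/-- The value of an entire function at a point of `ℂⁿ`. -/
instance : CoeFun (Entire n) (fun _ => (Fin n → ℂ) → ℂ) where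
  coe f := f.1

/-- The exponential `e ^ g` of an entire function `g`. -/
noncomputable def exp (g : Entire n) : Entire n :=
  ⟨fun z => Complex.exp (g z), Differentiable.cexp g.2⟩

/-- `f` is of order at most `ρ`: for every `ρ' > ρ` there is a constant `C` such that
`|f(z)| ≤ C e ^ (|z| ^ ρ')` on `ℂⁿ`, where `|z|` is the Euclidean norm. -/
def OrderAtMost (f : Entire n) (ρ : ℝ) : Prop :=
  ∀ ρ' : ℝ, ρ < ρ' →
    ∃ C : ℝ, ∀ z : Fin n → ℂ, ‖f z‖ ≤ C * Real.exp (‖WithLp.toLp 2 z‖ ^ ρ')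

/-- `f` is of finite order. -/
def FiniteOrder (f : Entire n) : Prop :=
  ∃ ρ : ℝ, 0 ≤ ρ ∧ OrderAtMost f ρ

/-- A polynomial on `ℂⁿ`, viewed as an entire function. -/
noncomputable def ofPolynomial (n : ℕ) : MvPolynomial (Fin n) ℂ →ₐ[ℂ] Entire n :=
  MvPolynomial.aeval fun i => ⟨fun z => z i, differentiable_apply i⟩

theorem ofPolynomial_apply (q : MvPolynomial (Fin n) ℂ) (z : Fin n → ℂ) :
    ofPolynomial n q z = MvPolynomial.eval z q := by
  induction q using MvPolynomial.induction_on with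
  | C a =>
    rw [MvPolynomial.eval_C]
    exact congrArg (fun g : Entire n => g z) ((ofPolynomial n).commutes a)
  | add p q hp hq => rw [map_add, map_add, ← hp, ← hq]; rfl
  | mul_X p i hp =>
    rw [map_mul, map_mul, ← hp, MvPolynomial.eval_X, ofPolynomial, MvPolynomial.aeval_X]; rfl

/-- Entire functions form an algebra over the polynomials. -/
noncomputable instance : Algebra (MvPolynomial (Fin n) ℂ) (Entire n) :=
  (ofPolynomial n).toRingHom.toAlgebra

theorem algebraMap_apply (q : MvPolynomial (Fin n) ℂ) (z : Fin n → ℂ) :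
    algebraMap (MvPolynomial (Fin n) ℂ) (Entire n) q z = MvPolynomial.eval z q :=
  ofPolynomial_apply q z

/-- A nonzero polynomial is not a zero divisor in the algebra of entire functions. -/
theorem eq_zero_of_algebraMap_mul_eq_zero {q : MvPolynomial (Fin n) ℂ} (hq : q ≠ 0)
    {h : Entire n} (hqh : algebraMap (MvPolynomial (Fin n) ℂ) (Entire n) q * h = 0) : h = 0 := by
  have hmul : ∀ z, MvPolynomial.eval z q * h z = 0 := fun z => by
    rw [← algebraMap_apply]
    exact congrArg (fun g : Entire n => g z) hqh
  obtain ⟨z₀, hz₀⟩ : ∃ z₀, MvPolynomial.eval z₀ q ≠ 0 := by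
    by_contra! hall
    exact hq (MvPolynomial.funext fun z => by simpa using hall z)
  refine Subtype.ext (funext fun z => ?_)
  change h z = 0
  let Q : Polynomial ℂ := MvPolynomial.aeval
    (fun i => Polynomial.C (z i) + Polynomial.X * Polynomial.C (z₀ i - z i)) q
  have hQ : ∀ t : ℂ, Q.eval t = MvPolynomial.eval (z + t • (z₀ - z)) q := fun t => by
    have hcomp : (Polynomial.aeval t).comp (MvPolynomial.aeval
        (fun i => Polynomial.C (z i) + Polynomial.X * Polynomial.C (z₀ i - z i))) =
        MvPolynomial.aeval (R := ℂ) (z + t • (z₀ - z)) := by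
      ext i
      simp
    have := congrArg (fun φ => φ q) hcomp
    simpa [Q, Polynomial.coe_aeval_eq_eval, MvPolynomial.coe_aeval_eq_eval] using this
  have hQ0 : Q ≠ 0 := fun h0 => hz₀ (by
    have := hQ 1
    rw [h0] at this
    simpa using this.symm)
  have hdense : Dense {t : ℂ | Q.eval t ≠ 0} := by
    have hfin : {t : ℂ | Q.eval t = 0}.Finite := by
      refine (Q.roots.toFinset.finite_toSet).subset fun t ht => ?_
      simpa [hQ0] using ht
    exact hfin.countable.dense_compl ℂ
  have hcont : Continuous fun t : ℂ => h (z + t • (z₀ - z)) :=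
    h.2.continuous.comp (by fun_prop)
  have hzero : (fun t : ℂ => h (z + t • (z₀ - z))) = fun _ => 0 :=
    hcont.ext_on hdense continuous_const fun t ht =>
      (mul_eq_zero.mp (hmul _)).resolve_left (by rw [← hQ]; exact ht)
  simpa using congrFun hzero 0

end Entire

/-- The field of rational functions on `ℂⁿ`. -/
abbrev RatFun (n : ℕ) : Type :=
  FractionRing (MvPolynomial (Fin n) ℂ)

/-- The algebra of meromorphic functions on `ℂⁿ` of the form `h / q`, with `h` entire and `q` a
nonzero polynomial. It is an algebra over the entire functions and over the field of rational
functions; `h₁ / q₁ = h₂ / q₂` means that `q₂ h₁ = q₁ h₂` on `ℂⁿ`. -/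
abbrev Mero (n : ℕ) : Type :=
  Localization
    (Algebra.algebraMapSubmonoid (Entire n) (nonZeroDivisors (MvPolynomial (Fin n) ℂ)))

/-- Entire functions embed into this algebra. -/
theorem Mero.algebraMap_injective (n : ℕ) :
    Function.Injective (algebraMap (Entire n) (Mero n)) := by
  refine IsLocalization.injective (Mero n) (M := Algebra.algebraMapSubmonoid (Entire n)
    (nonZeroDivisors (MvPolynomial (Fin n) ℂ))) ?_
  rintro _ ⟨q, hq, rfl⟩
  rw [mem_nonZeroDivisors_iff_right]
  intro h hh
  exact Entire.eq_zero_of_algebraMap_mul_eq_zero (nonZeroDivisors.ne_zero hq)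
    (by rw [mul_comm]; exact hh)

/-! Clearing denominators turns the hypothesis into A(f) = B e^p, where A has polynomial
coefficients and B ≠ 0 is a polynomial. Finite order bounds B e^p by the exponential of a
polynomial. The maximum principle divides out B (`exists_direction_norm_le`), so Re p has polynomial
growth, and p is a polynomial by Borel–Carathéodory and Liouville.

An affine substitution F = a f + r, with a the leading coefficient of A, brings the relation to the
depressed form Φ(F) = F^m + Σ_{k ≤ m-2} c_k F^k = B e^p, with a new B. Differentiate along a
coordinate with ∂p ≠ 0 and eliminate the exponential. With s = B ∂p + ∂B this gives Φ_w(F) · G =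
Σ_{k ≤ m-2} ψ_k F^k, where G = m B ∂F - s F and ψ_k = (m-k) s c_k - m B ∂c_k.

The factor Φ_w(F) has degree m-1 in F and the right side has smaller degree, so G has polynomial
growth where F is large. Where F is small, B e^p is small there and nearby, and Cauchy's estimate
bounds ∂F up to a factor 1/B. Hence B G has polynomial growth and is a polynomial Q
(`centered_polyBounded`). Multiplying the identity by B gives an algebraic relation for F, so
transcendence forces Q = 0 and all ψ_k = 0. If c_k ≠ 0, then ψ_k = 0 writes (m-k) ∂p as a
combination of logarithmic derivatives of polynomials, which is impossible by degrees
(`pderiv_eq_zero_of_logDeriv`). So Φ = w^m, and F e^{-p/m} is an entire m-th root of a polynomial,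
hence a polynomial. Undoing the substitution gives p₁ and p₂. -/

/-! ### Polynomial growth and Liouville's theorem -/

/-- An entire function of one variable growing at most like `|t| ^ N` is a polynomial of degree at
most `N`. -/
theorem exists_polynomial_of_norm_le_pow (N : ℕ) : ∀ (f : ℂ → ℂ), Differentiable ℂ f →
    (∃ C : ℝ, ∀ t, ‖f t‖ ≤ C * (1 + ‖t‖) ^ N) →
    ∃ q : Polynomial ℂ, q.natDegree ≤ N ∧ ∀ t, f t = q.eval t := by
  induction N with
  | zero =>
    rintro f hf ⟨C, hC⟩
    have hb : Bornology.IsBounded (Set.range f) := by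
      refine isBounded_iff_forall_norm_le.mpr ⟨C, ?_⟩
      rintro _ ⟨t, rfl⟩
      simpa using hC t
    obtain ⟨c, hc⟩ := hf.exists_const_forall_eq_of_bounded hb
    exact ⟨Polynomial.C c, by simp, fun t => by simp [hc]⟩
  | succ N ih =>
    rintro f hf ⟨C, hC⟩
    -- Replacing f by (f(t) - f(0)) / t lowers the growth exponent by one.
    have hg : Differentiable ℂ (dslope f 0) := by
      rw [← differentiableOn_univ] at hf ⊢
      exact (Complex.differentiableOn_dslope Filter.univ_mem).mpr hf
    have hC0 : 0 ≤ C := by simpa using (norm_nonneg _).trans (hC 0)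
    obtain ⟨M, hM⟩ := (isCompact_closedBall (0 : ℂ) 1).exists_bound_of_continuousOn
      hg.continuous.continuousOn
    have hM0 : 0 ≤ M := (norm_nonneg _).trans (hM 0 (by simp))
    -- M serves the unit disc. Outside it, |f(t) - f(0)| ≤ 2C(1+|t|)^(N+1) and 1+|t| ≤ 2|t| give the
    -- constant 4C.
    obtain ⟨q, hq, hq'⟩ := ih (dslope f 0) hg ⟨4 * C + M, fun t => by
      have h1 : 1 ≤ (1 + ‖t‖) ^ N := one_le_pow₀ (by linarith [norm_nonneg t])
      rcases le_total ‖t‖ 1 with ht | ht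
      · have := hM t (by simpa using ht)
        nlinarith
      · have ht0 : t ≠ 0 := by rintro rfl; simp at ht; linarith
        rw [dslope_of_ne _ ht0, slope_def_field, sub_zero, norm_div, div_le_iff₀ (by linarith)]
        have h2 : ‖f t - f 0‖ ≤ C * (1 + ‖t‖) ^ (N + 1) + C := by
          refine (norm_sub_le _ _).trans (add_le_add (hC t) ?_)
          simpa using hC 0
        have h3 : C ≤ C * (1 + ‖t‖) ^ (N + 1) :=
          le_mul_of_one_le_right hC0 (one_le_pow₀ (by linarith))
        have h4 : C * (1 + ‖t‖) ^ (N + 1) ≤ C * (1 + ‖t‖) ^ N * (2 * ‖t‖) := by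
          rw [pow_succ, ← mul_assoc]
          exact mul_le_mul_of_nonneg_left (by linarith) (by positivity)
        have h5 : 0 ≤ M * (1 + ‖t‖) ^ N * ‖t‖ := by positivity
        nlinarith⟩
    refine ⟨Polynomial.C (f 0) + Polynomial.X * q, ?_, fun t => ?_⟩
    · refine (Polynomial.natDegree_add_le _ _).trans (max_le (by simp) ?_)
      exact Polynomial.natDegree_mul_le.trans (by rw [Polynomial.natDegree_X]; omega)
    · have := sub_smul_dslope f 0 t
      rw [sub_zero, smul_eq_mul, hq'] at this
      simp [this]

/-- A nonnegative-constant polynomial bound for a real function on `ℂⁿ`. -/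
def PolyBounded {n : ℕ} (g : (Fin n → ℂ) → ℝ) : Prop :=
  ∃ C : ℝ, 0 ≤ C ∧ ∃ N : ℕ, ∀ z, g z ≤ C * (1 + ‖z‖) ^ N

namespace PolyBounded

variable {n : ℕ} {g h : (Fin n → ℂ) → ℝ}

theorem mono (hg : PolyBounded g) (hle : ∀ z, h z ≤ g z) : PolyBounded h := by
  obtain ⟨C, hC, N, hN⟩ := hg
  exact ⟨C, hC, N, fun z => (hle z).trans (hN z)⟩

theorem const (c : ℝ) : PolyBounded fun _ : Fin n → ℂ => c :=
  ⟨|c|, abs_nonneg c, 0, fun z => by simpa using le_abs_self c⟩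

theorem norm : PolyBounded fun z : Fin n → ℂ => ‖z‖ :=
  ⟨1, zero_le_one, 1, fun z => by simp⟩

theorem add (hg : PolyBounded g) (hh : PolyBounded h) : PolyBounded fun z => g z + h z := by
  obtain ⟨C, hC, N, hN⟩ := hg
  obtain ⟨C', hC', N', hN'⟩ := hh
  refine ⟨C + C', by positivity, N + N', fun z => ?_⟩
  have h1 : 1 ≤ 1 + ‖z‖ := by linarith [norm_nonneg z]
  calc g z + h z ≤ C * (1 + ‖z‖) ^ N + C' * (1 + ‖z‖) ^ N' := add_le_add (hN z) (hN' z)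
    _ ≤ C * (1 + ‖z‖) ^ (N + N') + C' * (1 + ‖z‖) ^ (N + N') := by
      gcongr <;> first | exact h1 | omega
    _ = _ := by ring

theorem mul (hg : PolyBounded g) (hh : PolyBounded h) (hh0 : ∀ z, 0 ≤ h z) :
    PolyBounded fun z => g z * h z := by
  obtain ⟨C, hC, N, hN⟩ := hg
  obtain ⟨C', hC', N', hN'⟩ := hh
  refine ⟨C * C', by positivity, N + N', fun z => ?_⟩
  calc g z * h z ≤ C * (1 + ‖z‖) ^ N * h z := mul_le_mul_of_nonneg_right (hN z) (hh0 z)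
    _ ≤ C * (1 + ‖z‖) ^ N * (C' * (1 + ‖z‖) ^ N') :=
      mul_le_mul_of_nonneg_left (hN' z) (by positivity)
    _ = _ := by ring

theorem sum {ι : Type*} (s : Finset ι) {g : ι → (Fin n → ℂ) → ℝ}
    (hg : ∀ i ∈ s, PolyBounded (g i)) : PolyBounded fun z => ∑ i ∈ s, g i z := by
  classical
  induction s using Finset.induction_on with
  | empty => simpa using const 0
  | insert a s ha ih =>
    simp only [Finset.sum_insert ha]
    exact (hg a (by simp)).add (ih fun i hi => hg i (by simp [hi]))

/-- A polynomially bounded function is polynomially bounded uniformly on balls of fixed radius. -/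
theorem exists_ball (hg : PolyBounded g) (r : ℝ) : ∃ g' : (Fin n → ℂ) → ℝ, PolyBounded g' ∧
    (∀ z, 0 ≤ g' z) ∧ ∀ z w, ‖w‖ ≤ ‖z‖ + r → g w ≤ g' z := by
  obtain ⟨C, hC, N, hN⟩ := hg
  refine ⟨fun z => C * (1 + |r|) ^ N * (1 + ‖z‖) ^ N, ⟨_, by positivity, N, fun z => le_rfl⟩,
    fun z => by positivity, fun z w hw => (hN w).trans ?_⟩
  dsimp only
  rw [mul_assoc, ← mul_pow]
  gcongr
  nlinarith [le_abs_self r, mul_nonneg (abs_nonneg r) (norm_nonneg z)]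

theorem eval (q : MvPolynomial (Fin n) ℂ) : PolyBounded fun z => ‖MvPolynomial.eval z q‖ := by
  induction q using MvPolynomial.induction_on with
  | C a => simpa using const ‖a‖
  | add p q hp hq => exact (hp.add hq).mono fun z => by simpa using norm_add_le _ _
  | mul_X p i hp =>
    refine (hp.mul norm fun z => norm_nonneg z).mono fun z => ?_
    rw [map_mul, norm_mul, MvPolynomial.eval_X]
    exact mul_le_mul_of_nonneg_left (norm_le_pi_norm z i) (norm_nonneg _)

end PolyBounded

theorem norm_update_le {n : ℕ} (z : Fin n → ℂ) (i : Fin n) (t : ℂ) :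
    ‖Function.update z i t‖ ≤ ‖z‖ + ‖t‖ := by
  refine (pi_norm_le_iff_of_nonneg (by positivity)).mpr fun j => ?_
  rcases eq_or_ne j i with rfl | hj
  · simp
  · rw [Function.update_of_ne hj]
    exact (norm_le_pi_norm z j).trans (by simp)

/-- A separately holomorphic function on `ℂⁿ` of polynomial growth is a polynomial. -/
theorem exists_mvPolynomial_of_polyBounded {n : ℕ} {g : (Fin n → ℂ) → ℂ}
    (hd : ∀ z i, Differentiable ℂ fun t => g (Function.update z i t))
    (hg : PolyBounded fun z => ‖g z‖) :
    ∃ q : MvPolynomial (Fin n) ℂ, ∀ z, g z = MvPolynomial.eval z q := by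
  -- Induction on a set S of variables on which g depends.
  suffices H : ∀ (S : Finset (Fin n)) (g : (Fin n → ℂ) → ℂ),
      (∀ z i, Differentiable ℂ fun t => g (Function.update z i t)) →
      (PolyBounded fun z => ‖g z‖) →
      (∀ z w, (∀ i ∈ S, z i = w i) → g z = g w) →
      ∃ q : MvPolynomial (Fin n) ℂ, ∀ z, g z = MvPolynomial.eval z q from
    H Finset.univ g hd hg fun z w h => by rw [funext fun i => h i (Finset.mem_univ i)]
  intro S
  induction S using Finset.induction_on with
  | empty =>
    intro g _ _ hc
    exact ⟨MvPolynomial.C (g 0), fun z => by simpa using hc z 0 (by simp)⟩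
  | insert i S hi ih =>
    intro g hd hg hS
    have hslice : ∀ j : ℕ, ∃ q : MvPolynomial (Fin n) ℂ,
        ∀ z, g (Function.update z i (j : ℂ)) = MvPolynomial.eval z q := by
      intro j
      refine ih (fun z => g (Function.update z i (j : ℂ))) (fun z k => ?_) ?_ fun z w h => ?_
      · rcases eq_or_ne k i with rfl | hk
        · simp
        · simp_rw [Function.update_comm hk]
          exact hd _ k
      · obtain ⟨g', hg', -, hle⟩ := hg.exists_ball j
        exact hg'.mono fun z => hle _ _ (by simpa using norm_update_le z i (j : ℂ))
      · refine hS _ _ fun k hk => ?_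
        rcases eq_or_ne k i with rfl | hki
        · simp
        · rw [Function.update_of_ne hki, Function.update_of_ne hki]
          exact h k ((Finset.mem_insert.mp hk).resolve_left hki)
    choose q hq using hslice
    obtain ⟨C, hC, N, hN⟩ := hg
    let v : ℕ → ℂ := fun j => (j : ℂ)
    have hv : Set.InjOn v (Finset.range (N + 1) : Set ℕ) := fun a _ b _ h => by
      simpa [v] using h
    -- In the i-th variable g is a polynomial of degree at most N, with N independent of the other
    -- variables. Its slices at the nodes 0, ..., N therefore determine it by interpolation, and
    -- these slices no longer depend on the i-th variable.
    refine ⟨∑ j ∈ Finset.range (N + 1), q j *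
      Polynomial.aeval (MvPolynomial.X i) (Lagrange.basis (Finset.range (N + 1)) v j), fun z => ?_⟩
    obtain ⟨r, hr, hr'⟩ := exists_polynomial_of_norm_le_pow N _ (hd z i)
      ⟨C * (1 + ‖z‖) ^ N, fun t => (hN _).trans (by
        rw [mul_assoc, ← mul_pow]
        gcongr
        nlinarith [norm_update_le z i t, mul_nonneg (norm_nonneg z) (norm_nonneg t)])⟩
    have hdeg : r.degree < (Finset.range (N + 1)).card := by
      rw [Finset.card_range]
      exact (Polynomial.degree_le_of_natDegree_le hr).trans_lt (by exact_mod_cast Nat.lt_succ_self N)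
    have h1 := Lagrange.eq_interpolate hv hdeg
    have h2 : g z = r.eval (z i) := by rw [← hr', Function.update_eq_self]
    rw [h2, h1, Lagrange.interpolate_apply, Polynomial.eval_finsetSum, map_sum]
    refine Finset.sum_congr rfl fun j _ => ?_
    rw [Polynomial.eval_mul, Polynomial.eval_C, map_mul, ← hq, ← hr']
    congr 1
    have hcomp : ((MvPolynomial.aeval z : MvPolynomial (Fin n) ℂ →ₐ[ℂ] ℂ)).comp
        (Polynomial.aeval (MvPolynomial.X i)) = Polynomial.aeval (z i) := by
      ext; simp
    have := congrArg (fun φ => φ (Lagrange.basis (Finset.range (N + 1)) v j)) hcomp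
    simpa [Polynomial.coe_aeval_eq_eval, MvPolynomial.coe_aeval_eq_eval] using this.symm

/-- Schwarz's lemma applied twice: to φ - φ(0), bounded by 2M, and then to the slope minus its value
at 0, bounded by 4M. The constant depends on φ only through M, so difference quotients converge
uniformly over families with a common bound. -/
theorem norm_dslope_sub_deriv_le {φ : ℂ → ℂ} (hφ : Differentiable ℂ φ) {M : ℝ}
    (hM : ∀ t, ‖t‖ ≤ 1 → ‖φ t‖ ≤ M) {h : ℂ} (hh : ‖h‖ < 1) :
    ‖dslope φ 0 h - deriv φ 0‖ ≤ (4 * M) * ‖h‖ := by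
  have hg : Differentiable ℂ (dslope φ 0) := by
    rw [← differentiableOn_univ] at hφ ⊢
    exact (Complex.differentiableOn_dslope Filter.univ_mem).mpr hφ
  have h1 : ∀ t ∈ Metric.ball (0 : ℂ) 1, ‖dslope φ 0 t‖ ≤ 2 * M := fun t ht => by
    have := Complex.norm_dslope_le_div_of_mapsTo_ball (R₂ := 2 * M) hφ.differentiableOn
      (fun s hs => ?_) ht
    · simpa using this
    · rw [mem_closedBall_iff_norm]
      refine (norm_sub_le _ _).trans ?_
      have := hM s (by simpa using (Metric.mem_ball.mp hs).le)
      have := hM 0 (by simp)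
      linarith
  have h2 := Complex.dist_le_div_mul_dist_of_mapsTo_ball (R₂ := 4 * M) (z := h)
    (hg.differentiableOn (s := Metric.ball 0 1)) (fun s hs => ?_) (by simpa using hh)
  · simpa [dist_eq_norm] using h2
  · rw [mem_closedBall_iff_norm]
    refine (norm_sub_le _ _).trans ?_
    have := h1 s hs
    have := h1 0 (by simp)
    linarith

/-! ### Holomorphy along lines and Cauchy's estimate -/

section Lines

variable {n : ℕ} {F : (Fin n → ℂ) → ℂ}

theorem hasDerivAt_line (hF : Differentiable ℂ F) (z v : Fin n → ℂ) (t : ℂ) :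
    HasDerivAt (fun t : ℂ => F (z + t • v)) (fderiv ℂ F (z + t • v) v) t := by
  have h1 : HasDerivAt (fun t : ℂ => z + t • v) v t := by
    simpa using ((hasDerivAt_id t).smul_const v).const_add z
  exact (hF (z + t • v)).hasFDerivAt.comp_hasDerivAt t h1

theorem differentiable_line (hF : Differentiable ℂ F) (z v : Fin n → ℂ) :
    Differentiable ℂ fun t : ℂ => F (z + t • v) :=
  fun t => (hasDerivAt_line hF z v t).differentiableAt

/-- Directional derivatives of an entire function are holomorphic along lines. -/
theorem differentiable_fderiv_line (hF : Differentiable ℂ F) (z u v : Fin n → ℂ) :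
    Differentiable ℂ fun s : ℂ => fderiv ℂ F (z + s • u) v := by
  -- Difference quotients in the direction v are holomorphic in s and converge locally uniformly to
  -- the derivative. The step 1/(k+2) is less than 1 even for k = 0.
  let Fk : ℕ → ℂ → ℂ := fun k s =>
    dslope (fun t : ℂ => F (z + s • u + t • v)) 0 ((1 / ((k : ℝ) + 2) : ℝ) : ℂ)
  have hne : ∀ k : ℕ, ((1 / ((k : ℝ) + 2) : ℝ) : ℂ) ≠ 0 := fun k => by
    exact_mod_cast (by positivity : (1 / ((k : ℝ) + 2) : ℝ) ≠ 0)
  have hnorm : ∀ k : ℕ, ‖((1 / ((k : ℝ) + 2) : ℝ) : ℂ)‖ = 1 / ((k : ℝ) + 2) := fun k => by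
    rw [Complex.norm_real, Real.norm_of_nonneg (by positivity)]
  have hd : ∀ k, Differentiable ℂ (Fk k) := fun k => by
    have : Fk k = fun s => (F (z + ((1 / ((k : ℝ) + 2) : ℝ) : ℂ) • v + s • u) - F (z + s • u)) /
        ((1 / ((k : ℝ) + 2) : ℝ) : ℂ) := by
      funext s
      simp only [Fk]
      rw [dslope_of_ne _ (hne k), slope_def_field, sub_zero, zero_smul, add_zero,
        add_right_comm]
    rw [this]
    exact ((differentiable_line hF _ u).sub (differentiable_line hF z u)).div_const _
  rw [← differentiableOn_univ]
  refine TendstoLocallyUniformlyOn.differentiableOn (F := Fk) (φ := Filter.atTop) ?_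
    (Filter.Eventually.of_forall fun k => (hd k).differentiableOn) isOpen_univ
  rw [tendstoLocallyUniformlyOn_iff_forall_isCompact isOpen_univ]
  intro K _ hK
  obtain ⟨M, hM⟩ := (hK.prod (isCompact_closedBall (0 : ℂ) 1)).exists_bound_of_continuousOn
    (f := fun x : ℂ × ℂ => F (z + x.1 • u + x.2 • v))
    (hF.continuous.comp (by fun_prop)).continuousOn
  rw [Metric.tendstoUniformlyOn_iff]
  intro ε hε
  have hlim : Filter.Tendsto (fun k : ℕ => (4 * M) * (1 / ((k : ℝ) + 2))) Filter.atTop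
      (nhds 0) := by
    have := ((tendsto_one_div_add_atTop_nhds_zero_nat (𝕜 := ℝ)).comp
      (Filter.tendsto_add_atTop_nat 1)).const_mul (4 * M)
    rw [mul_zero] at this
    refine this.congr fun k => ?_
    simp only [Function.comp, Nat.cast_add, Nat.cast_one]
    rw [add_assoc, one_add_one_eq_two]
  filter_upwards [hlim.eventually (gt_mem_nhds hε)] with k hk s hs
  refine lt_of_le_of_lt ?_ hk
  rw [dist_comm, dist_eq_norm, ← hnorm]
  have h3 := (hasDerivAt_line hF (z + s • u) v 0).deriv
  rw [zero_smul, add_zero] at h3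
  rw [← h3]
  refine norm_dslope_sub_deriv_le (differentiable_line hF _ v)
    (fun t ht => hM (s, t) ⟨hs, by simpa using ht⟩) ?_
  rw [hnorm, div_lt_one (by positivity)]
  linarith [(k.cast_nonneg : (0 : ℝ) ≤ k)]

theorem update_eq_add_smul (z : Fin n → ℂ) (i : Fin n) (t : ℂ) :
    Function.update z i t = Function.update z i 0 + t • Pi.single i 1 := by
  ext j
  rcases eq_or_ne j i with rfl | hj <;> simp [*]

theorem differentiable_fderiv_update (hF : Differentiable ℂ F) (v z : Fin n → ℂ) (i : Fin n) :
    Differentiable ℂ fun t : ℂ => fderiv ℂ F (Function.update z i t) v := by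
  simpa only [← update_eq_add_smul] using
    differentiable_fderiv_line hF (Function.update z i 0) (Pi.single i 1) v

theorem differentiable_update (hF : Differentiable ℂ F) (z : Fin n → ℂ) (i : Fin n) :
    Differentiable ℂ fun t : ℂ => F (Function.update z i t) := by
  simpa only [← update_eq_add_smul] using
    differentiable_line hF (Function.update z i 0) (Pi.single i 1)

/-- Cauchy's estimate for a directional derivative. -/
theorem norm_fderiv_apply_le (hF : Differentiable ℂ F) (z v : Fin n → ℂ) {δ X : ℝ} (hδ : 0 < δ)
    (hX : ∀ t : ℂ, ‖t‖ = δ → ‖F (z + t • v)‖ ≤ X) : ‖fderiv ℂ F z v‖ ≤ X / δ := by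
  have h := Complex.norm_deriv_le_of_forall_mem_sphere_norm_le (c := 0) hδ
    (differentiable_line hF z v).diffContOnCl fun t ht => hX t (by simpa using ht)
  rwa [(hasDerivAt_line hF z v 0).deriv, zero_smul, add_zero] at h

end Lines

/-! ### Derivatives of polynomials as functions -/

section Eval

variable {n : ℕ}

theorem norm_single_one_le (i : Fin n) : ‖(Pi.single i 1 : Fin n → ℂ)‖ ≤ 1 := by
  refine (pi_norm_le_iff_of_nonneg zero_le_one).mpr fun j => ?_
  rcases eq_or_ne j i with rfl | hj <;> simp [*]

theorem hasFDerivAt_eval_single (q : MvPolynomial (Fin n) ℂ) (z : Fin n → ℂ) :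
    ∃ L : (Fin n → ℂ) →L[ℂ] ℂ, HasFDerivAt (fun z => MvPolynomial.eval z q) L z ∧
      ∀ i, L (Pi.single i 1) = MvPolynomial.eval z (MvPolynomial.pderiv i q) := by
  induction q using MvPolynomial.induction_on with
  | C a => exact ⟨0, by simpa using hasFDerivAt_const a z, by simp⟩
  | add p q hp hq =>
    obtain ⟨L, hL, hL'⟩ := hp
    obtain ⟨K, hK, hK'⟩ := hq
    exact ⟨L + K, by simp only [map_add]; exact hL.add hK, by simp [hL', hK']⟩
  | mul_X p j hp =>
    obtain ⟨L, hL, hL'⟩ := hp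
    refine ⟨_, by
      simp only [map_mul, MvPolynomial.eval_X]
      exact hL.mul (hasFDerivAt_apply (𝕜 := ℂ) j z), fun i => ?_⟩
    rcases eq_or_ne i j with rfl | hij
    · simp [hL']
    · simp [hL', MvPolynomial.pderiv_X_of_ne hij.symm, hij.symm]

theorem differentiable_eval (q : MvPolynomial (Fin n) ℂ) :
    Differentiable ℂ fun z => MvPolynomial.eval z q := fun z => by
  obtain ⟨L, hL, -⟩ := hasFDerivAt_eval_single q z
  exact hL.differentiableAt

theorem fderiv_eval_single (q : MvPolynomial (Fin n) ℂ) (z : Fin n → ℂ) (i : Fin n) :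
    fderiv ℂ (fun z => MvPolynomial.eval z q) z (Pi.single i 1) =
      MvPolynomial.eval z (MvPolynomial.pderiv i q) := by
  obtain ⟨L, hL, hL'⟩ := hasFDerivAt_eval_single q z
  rw [hL.fderiv, hL']

/-- A polynomial is Lipschitz along unit steps in a coordinate direction, with a polynomially
bounded constant. -/
theorem exists_norm_eval_sub_le (q : MvPolynomial (Fin n) ℂ) (i : Fin n) :
    ∃ Y : (Fin n → ℂ) → ℝ, PolyBounded Y ∧ (∀ z, 0 ≤ Y z) ∧ ∀ z (t : ℂ), ‖t‖ ≤ 1 →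
      ‖MvPolynomial.eval (z + t • Pi.single i 1) q - MvPolynomial.eval z q‖ ≤ Y z * ‖t‖ := by
  obtain ⟨Y, hY, hY0, hle⟩ := (PolyBounded.eval (MvPolynomial.pderiv i q)).exists_ball 1
  refine ⟨Y, hY, hY0, fun z t ht => ?_⟩
  have h := Convex.norm_image_sub_le_of_norm_hasDerivWithin_le (𝕜 := ℂ) (C := Y z)
    (f := fun t : ℂ => MvPolynomial.eval (z + t • Pi.single i 1) q)
    (fun s _ => (hasDerivAt_line (differentiable_eval q) z (Pi.single i 1) s).hasDerivWithinAt)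
    (fun s hs => ?_) (convex_closedBall (0 : ℂ) 1) (Metric.mem_closedBall_self zero_le_one)
    (by simpa using ht : t ∈ Metric.closedBall (0 : ℂ) 1)
  · simpa using h
  · rw [fderiv_eval_single]
    refine hle _ _ ((norm_add_le _ _).trans ?_)
    rw [norm_smul]
    have h1 : ‖(Pi.single i 1 : Fin n → ℂ)‖ ≤ 1 := norm_single_one_le i
    have h2 : ‖s‖ ≤ 1 := by simpa using hs
    gcongr
    exact mul_le_one₀ h2 (norm_nonneg _) h1

end Eval

/-! ### Dividing a bound by a polynomial -/

section Division

variable {n : ℕ}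

/-- A monomial of maximal degree survives in the top component. The point found is a direction along
which B keeps its full degree from every base point, with the same leading coefficient. -/
theorem exists_eval_homogeneousComponent_ne_zero {B : MvPolynomial (Fin n) ℂ} (hB : B ≠ 0) :
    ∃ b : Fin n → ℂ,
      MvPolynomial.eval b (MvPolynomial.homogeneousComponent B.totalDegree B) ≠ 0 := by
  by_contra! h
  have h0 : MvPolynomial.homogeneousComponent B.totalDegree B = 0 :=
    MvPolynomial.funext fun z => by simpa using h z
  obtain ⟨s, hs, hs'⟩ := B.support.exists_mem_eq_sup
    (Finset.nonempty_iff_ne_empty.mpr (by simpa using hB)) fun s => s.degree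
  have hdeg : s.degree = B.totalDegree := by
    rw [← hs']
    rfl
  have := congrArg (MvPolynomial.coeff s) h0
  rw [MvPolynomial.coeff_homogeneousComponent, if_pos hdeg] at this
  exact MvPolynomial.mem_support_iff.mp hs this

/-- Reversing a polynomial along a line. -/
theorem exists_reverse_line (B : MvPolynomial (Fin n) ℂ) (z b : Fin n → ℂ) :
    ∃ N : ℂ → ℂ, Differentiable ℂ N ∧
      N 0 = MvPolynomial.eval b (MvPolynomial.homogeneousComponent B.totalDegree B) ∧
      ∀ t, t ≠ 0 → N t = t ^ B.totalDegree * MvPolynomial.eval (z + t⁻¹ • b) B := by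
  refine ⟨fun t => ∑ s ∈ B.support, B.coeff s * t ^ (B.totalDegree - s.degree) *
    ∏ i, (b i + t * z i) ^ s i, by fun_prop, ?_, fun t ht => ?_⟩
  · rw [MvPolynomial.homogeneousComponent_apply, map_sum, Finset.sum_filter]
    refine Finset.sum_congr rfl fun s hs => ?_
    have hle : s.degree ≤ B.totalDegree := MvPolynomial.le_totalDegree hs
    split_ifs with h
    · simp [h, MvPolynomial.eval_monomial, Finsupp.prod_fintype]
    · rw [zero_pow (by omega)]
      simp
  · rw [MvPolynomial.eval_eq', Finset.mul_sum]
    refine Finset.sum_congr rfl fun s hs => ?_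
    have hle : s.degree ≤ B.totalDegree := MvPolynomial.le_totalDegree hs
    have h1 : ∀ i, b i + t * z i = t * (z + t⁻¹ • b) i := fun i => by
      simp only [Pi.add_apply, Pi.smul_apply, smul_eq_mul]
      field_simp
      ring
    have h2 : ∏ i, t ^ s i = t ^ s.degree := by
      rw [Finset.prod_pow_eq_pow_sum, Finsupp.degree_eq_sum]
    simp_rw [h1, mul_pow]
    rw [Finset.prod_mul_distrib, h2, ← pow_sub_mul_pow t hle]
    ring

/-- A nonzero polynomial can be divided out of a bound for an entire function, at the price of
enlarging the region by a fixed amount. -/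
theorem exists_direction_norm_le {B : MvPolynomial (Fin n) ℂ} (hB : B ≠ 0) :
    ∃ (b : Fin n → ℂ) (c : ℝ), 0 < c ∧ ∀ F : (Fin n → ℂ) → ℂ, Differentiable ℂ F → ∀ z M,
      (∀ t : ℂ, ‖t‖ = 1 → ‖MvPolynomial.eval (z + t • b) B * F (z + t • b)‖ ≤ M) →
      c * ‖F z‖ ≤ M := by
  obtain ⟨b, hb⟩ := exists_eval_homogeneousComponent_ne_zero hB
  refine ⟨b, _, norm_pos_iff.mpr hb, fun F hF z M hM => ?_⟩
  obtain ⟨N, hN, hN0, hNt⟩ := exists_reverse_line B z b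
  -- On |t| = 1 the inverse of the conjugate of t is t, so the conjugated reversal has the modulus
  -- of B(z + t b). At t = 0 its modulus is that of the top component at b, which does not depend on
  -- z. The maximum principle for its product with F therefore gives a uniform c.
  have hd : Differentiable ℂ fun t => (starRingEnd ℂ) (N ((starRingEnd ℂ) t)) * F (z + t • b) :=
    Differentiable.mul (fun t => by
      have := (hN ((starRingEnd ℂ) t)).conj_conj
      rwa [Complex.conj_conj] at this) (differentiable_line hF z b)
  have h := Complex.norm_le_of_forall_mem_frontier_norm_le (Metric.isBounded_ball (x := (0 : ℂ))
    (r := 1)) hd.diffContOnCl (C := M) (z := 0) (fun t ht => ?_)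
    (subset_closure (Metric.mem_ball_self zero_lt_one))
  · simpa [hN0] using h
  · rw [frontier_ball _ one_ne_zero, mem_sphere_zero_iff_norm] at ht
    have ht0 : (starRingEnd ℂ) t ≠ 0 := by
      rw [Ne, map_eq_zero]
      rintro rfl
      simp at ht
    have hinv : ((starRingEnd ℂ) t)⁻¹ = t := by
      rw [← Complex.inv_eq_conj ht, inv_inv]
    have := hM t ht
    rw [norm_mul, RCLike.norm_conj, hNt _ ht0, hinv, norm_mul, norm_pow, RCLike.norm_conj, ht,
      one_pow, one_mul, ← norm_mul]
    exact this

end Division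

/-! ### Finite order forces the exponent to be a polynomial -/

section FiniteOrder

variable {n : ℕ}

/-- An entire function whose real part is polynomially bounded above is polynomially bounded. -/
theorem polyBounded_of_re {p : (Fin n → ℂ) → ℂ} (hp : Differentiable ℂ p)
    (hre : PolyBounded fun z => (p z).re) : PolyBounded fun z => ‖p z‖ := by
  obtain ⟨C, hC, N, hN⟩ := hre
  refine PolyBounded.mono (g := fun z => 2 * ((C + 1) * 2 ^ N * (1 + ‖z‖) ^ N) + 3 * ‖p 0‖)
    (PolyBounded.add
      ⟨2 * ((C + 1) * 2 ^ N), by positivity, N, fun z => by simp only [mul_assoc, le_refl]⟩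
      (PolyBounded.const _)) fun z => ?_
  -- Radii 1 and 2 on the line through z produce the factors 2 and 3. Using C + 1 keeps the majorant
  -- strictly positive.
  have h := Complex.borelCaratheodory (f := fun t : ℂ => p (0 + t • z)) (z := 1) (R := 2)
    (M := (C + 1) * 2 ^ N * (1 + ‖z‖) ^ N) (by positivity)
    (differentiable_line hp 0 z).differentiableOn (fun t ht => ?_) two_pos (by simp)
  · norm_num at h
    linarith
  · have ht' : ‖t‖ < 2 := by simpa using ht
    refine (hN _).trans ?_
    rw [mul_assoc, ← mul_pow, zero_add, norm_smul]
    have : ‖t‖ * ‖z‖ ≤ 2 * ‖z‖ := by gcongr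
    gcongr
    · linarith
    · linarith

/-- The functions bounded by `exp` of a polynomial bound. -/
def ExpBounded (g : (Fin n → ℂ) → ℂ) : Prop :=
  ∃ h : (Fin n → ℂ) → ℝ, PolyBounded h ∧ ∀ z, ‖g z‖ ≤ Real.exp (h z)

namespace ExpBounded

variable {g h : (Fin n → ℂ) → ℂ}

theorem of_polyBounded (hg : PolyBounded fun z => ‖g z‖) : ExpBounded g :=
  ⟨_, hg, fun z => by linarith [Real.add_one_le_exp ‖g z‖]⟩

theorem mul (hg : ExpBounded g) (hh : ExpBounded h) : ExpBounded fun z => g z * h z := by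
  obtain ⟨a, ha, ha'⟩ := hg
  obtain ⟨b, hb, hb'⟩ := hh
  refine ⟨_, ha.add hb, fun z => ?_⟩
  rw [norm_mul, Real.exp_add]
  exact mul_le_mul (ha' z) (hb' z) (norm_nonneg _) (Real.exp_nonneg _)

theorem add (hg : ExpBounded g) (hh : ExpBounded h) : ExpBounded fun z => g z + h z := by
  obtain ⟨a, ha, ha'⟩ := hg
  obtain ⟨b, hb, hb'⟩ := hh
  obtain ⟨a₁, ha₁, ha₁0, hle⟩ := ha.exists_ball 0
  obtain ⟨b₁, hb₁, hb₁0, hle'⟩ := hb.exists_ball 0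
  refine ⟨_, (ha₁.add hb₁).add (PolyBounded.const 1), fun z => ?_⟩
  have h1 : ‖g z‖ ≤ Real.exp (a₁ z + b₁ z) :=
    (ha' z).trans (Real.exp_le_exp.mpr (by linarith [hle z z (by simp), hb₁0 z]))
  have h2 : ‖h z‖ ≤ Real.exp (a₁ z + b₁ z) :=
    (hb' z).trans (Real.exp_le_exp.mpr (by linarith [hle' z z (by simp), ha₁0 z]))
  rw [Real.exp_add]
  have h3 : (2 : ℝ) ≤ Real.exp 1 := by linarith [Real.add_one_le_exp (1 : ℝ)]
  refine (norm_add_le _ _).trans ?_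
  nlinarith [Real.exp_pos (a₁ z + b₁ z)]

theorem sum {ι : Type*} (s : Finset ι) {g : ι → (Fin n → ℂ) → ℂ}
    (hg : ∀ i ∈ s, ExpBounded (g i)) : ExpBounded fun z => ∑ i ∈ s, g i z := by
  classical
  induction s using Finset.induction_on with
  | empty => exact of_polyBounded (by simpa using PolyBounded.const 0)
  | insert a s ha ih =>
    simp only [Finset.sum_insert ha]
    exact (hg a (by simp)).add (ih fun i hi => hg i (by simp [hi]))

theorem pow (hg : ExpBounded g) (k : ℕ) : ExpBounded fun z => g z ^ k := by
  induction k with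
  | zero => exact of_polyBounded (by simpa using PolyBounded.const 1)
  | succ k ih => simpa only [pow_succ] using ih.mul hg

theorem eval (q : MvPolynomial (Fin n) ℂ) : ExpBounded fun z => MvPolynomial.eval z q :=
  of_polyBounded (PolyBounded.eval q)

end ExpBounded

/-- A natural exponent above the order makes the bound the exponential of a polynomial one. The
constant K compares the Euclidean norm with the sup norm used in `PolyBounded`. -/
theorem Entire.FiniteOrder.expBounded {f : Entire n} (hf : Entire.FiniteOrder f) :
    ExpBounded fun z => f z := by
  obtain ⟨ρ, hρ, hf⟩ := hf
  obtain ⟨N, hN⟩ := exists_nat_gt ρ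
  obtain ⟨C, hC⟩ := hf N hN
  obtain ⟨K, hK⟩ : ∃ K : ℝ, ∀ z : Fin n → ℂ, ‖WithLp.toLp 2 z‖ ≤ K * ‖z‖ :=
    ⟨_, fun z => ContinuousLinearMap.le_opNorm
      (PiLp.continuousLinearEquiv 2 ℂ fun _ : Fin n => ℂ).symm.toContinuousLinearMap z⟩
  refine ⟨fun z => |C| + (|K| * (1 + ‖z‖)) ^ N, (PolyBounded.const _).add
    ⟨|K| ^ N, by positivity, N, fun z => by simp only [mul_pow, le_refl]⟩, fun z => (hC z).trans ?_⟩
  rw [Real.exp_add, Real.rpow_natCast]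
  have h1 : C ≤ Real.exp |C| := by linarith [Real.add_one_le_exp |C|, le_abs_self C]
  have h2 : ‖WithLp.toLp 2 z‖ ≤ |K| * (1 + ‖z‖) := by
    have := mul_le_mul_of_nonneg_right (le_abs_self K) (norm_nonneg z)
    linarith [hK z, abs_nonneg K]
  gcongr

/-- If `B e ^ p` has at most exponential-polynomial growth for a nonzero polynomial `B`, then the
entire function `p` is a polynomial. -/
theorem exists_mvPolynomial_of_expBounded {B : MvPolynomial (Fin n) ℂ} (hB : B ≠ 0)
    {p : (Fin n → ℂ) → ℂ} (hp : Differentiable ℂ p)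
    (h : ExpBounded fun z => MvPolynomial.eval z B * Complex.exp (p z)) :
    ∃ q : MvPolynomial (Fin n) ℂ, ∀ z, p z = MvPolynomial.eval z q := by
  obtain ⟨b, c, hc, hdiv⟩ := exists_direction_norm_le hB
  obtain ⟨g, hg, hg'⟩ := h
  obtain ⟨g₁, hg₁, -, hle⟩ := hg.exists_ball ‖b‖
  refine exists_mvPolynomial_of_polyBounded (fun z i => differentiable_update hp z i)
    (polyBounded_of_re hp ((hg₁.add (PolyBounded.const (-Real.log c))).mono fun z => ?_))
  have h1 : c * ‖Complex.exp (p z)‖ ≤ Real.exp (g₁ z) :=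
    hdiv _ hp.cexp z _ fun t ht => (hg' _).trans (Real.exp_le_exp.mpr (hle _ _
      ((norm_add_le _ _).trans (by rw [norm_smul, ht, one_mul]))))
  rw [Complex.norm_exp] at h1
  have h2 := Real.log_le_log (by positivity) h1
  rw [Real.log_exp, Real.log_mul hc.ne' (Real.exp_ne_zero _), Real.log_exp] at h2
  linarith

end FiniteOrder

/-! ### Degrees and logarithmic derivatives -/

section DegreeArgument

variable {n : ℕ}

theorem totalDegree_pderiv_lt {A : MvPolynomial (Fin n) ℂ} {i : Fin n}
    (hA : MvPolynomial.pderiv i A ≠ 0) :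
    (MvPolynomial.pderiv i A).totalDegree < A.totalDegree := by
  obtain ⟨s, hs, hs'⟩ := (MvPolynomial.pderiv i A).support.exists_mem_eq_sup
    (Finset.nonempty_iff_ne_empty.mpr (by simpa using hA)) fun s => s.degree
  have hdeg : (MvPolynomial.pderiv i A).totalDegree = s.degree := hs'
  rw [MvPolynomial.mem_support_iff, MvPolynomial.coeff_pderiv] at hs
  have h : (s + Finsupp.single i 1).degree ≤ A.totalDegree :=
    MvPolynomial.le_totalDegree (MvPolynomial.mem_support_iff.mpr (left_ne_zero_of_mul hs))
  rw [map_add, Finsupp.degree_single] at h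
  omega

/-- The derivative of a nonconstant polynomial is not a combination of logarithmic derivatives of
polynomials. -/
theorem pderiv_eq_zero_of_logDeriv {i : Fin n} {A B p : MvPolynomial (Fin n) ℂ} (hA : A ≠ 0)
    (hB : B ≠ 0) {a b c : ℂ} (hc : c ≠ 0)
    (h : MvPolynomial.C c * (A * B * MvPolynomial.pderiv i p) =
      MvPolynomial.C a * (B * MvPolynomial.pderiv i A) -
        MvPolynomial.C b * (A * MvPolynomial.pderiv i B)) :
    MvPolynomial.pderiv i p = 0 := by
  by_contra hp
  have hc' : (MvPolynomial.C c : MvPolynomial (Fin n) ℂ) ≠ 0 := by simpa using hc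
  -- The left side has degree at least deg(AB), while differentiation makes each term on the right
  -- drop below it.
  have hL : (A * B).totalDegree ≤
      (MvPolynomial.C c * (A * B * MvPolynomial.pderiv i p)).totalDegree :=
    MvPolynomial.totalDegree_le_of_dvd_of_isDomain (Dvd.intro _ (by ring : (A * B) *
      (MvPolynomial.C c * MvPolynomial.pderiv i p) = _)) (by simp [hc, hA, hB, hp])
  -- Since `totalDegree 0 = 0`, the strict drop needs AB to be nonconstant.
  have hne : MvPolynomial.pderiv i A ≠ 0 ∨ MvPolynomial.pderiv i B ≠ 0 := by
    by_contra! h0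
    rw [h0.1, h0.2] at h
    simp [hc, hA, hB, hp] at h
  have key : ∀ (d : ℂ) (S T : MvPolynomial (Fin n) ℂ), S ≠ 0 → T ≠ 0 → 0 < (A * B).totalDegree →
      S.totalDegree + T.totalDegree = (A * B).totalDegree →
      (MvPolynomial.C d * (S * MvPolynomial.pderiv i T)).totalDegree < (A * B).totalDegree := by
    intro d S T hS hT hpos hST
    rcases eq_or_ne (MvPolynomial.pderiv i T) 0 with h0 | h0
    · simpa [h0] using hpos
    · have h1 := totalDegree_pderiv_lt h0
      have h2 := MvPolynomial.totalDegree_mul (MvPolynomial.C d) (S * MvPolynomial.pderiv i T)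
      have h3 := MvPolynomial.totalDegree_mul S (MvPolynomial.pderiv i T)
      rw [MvPolynomial.totalDegree_C] at h2
      omega
  have hAB := MvPolynomial.totalDegree_mul_of_isDomain hA hB
  have hpos : 0 < (A * B).totalDegree := by
    rcases hne with h0 | h0 <;> have := totalDegree_pderiv_lt h0 <;> omega
  have hR := MvPolynomial.totalDegree_sub (MvPolynomial.C a * (B * MvPolynomial.pderiv i A))
    (MvPolynomial.C b * (A * MvPolynomial.pderiv i B))
  rw [← h] at hR
  have h1 := key a B A hB hA hpos (by omega)
  have h2 := key b A B hA hB hpos (by omega)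
  have := hL.trans hR
  omega

end DegreeArgument

theorem PolyBounded.pow {n : ℕ} {g : (Fin n → ℂ) → ℝ} (hg : PolyBounded g) (hg0 : ∀ z, 0 ≤ g z)
    (k : ℕ) : PolyBounded fun z => g z ^ k := by
  induction k with
  | zero => simpa using PolyBounded.const 1
  | succ k ih => simpa only [pow_succ] using ih.mul hg hg0

/-- A root of a monic polynomial is bounded by its coefficients. -/
theorem norm_le_of_monic_eq {m : ℕ} (hm : 1 ≤ m) {a : ℕ → ℂ} {w v : ℂ}
    (h : w ^ m + ∑ k ∈ Finset.range (m - 1), a k * w ^ k = v) :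
    ‖w‖ ≤ 1 + ∑ k ∈ Finset.range (m - 1), ‖a k‖ + ‖v‖ := by
  have hS : 0 ≤ ∑ k ∈ Finset.range (m - 1), ‖a k‖ := Finset.sum_nonneg fun _ _ => norm_nonneg _
  rcases le_total ‖w‖ 1 with hw | hw
  · linarith [norm_nonneg v]
  have h1 : ‖∑ k ∈ Finset.range (m - 1), a k * w ^ k‖ ≤
      (∑ k ∈ Finset.range (m - 1), ‖a k‖) * ‖w‖ ^ (m - 1) := by
    rw [Finset.sum_mul]
    refine norm_sum_le_of_le _ fun k hk => ?_
    rw [norm_mul, norm_pow]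
    exact mul_le_mul_of_nonneg_left (pow_le_pow_right₀ hw (Finset.mem_range.mp hk).le)
      (norm_nonneg _)
  have h2 : ‖w‖ ^ (m - 1) * ‖w‖ ≤ ‖v‖ + ‖∑ k ∈ Finset.range (m - 1), a k * w ^ k‖ := by
    rw [← pow_succ, Nat.sub_add_cancel hm, ← norm_pow, ← h]
    exact norm_le_add_norm_add _ _
  have h3 : 1 ≤ ‖w‖ ^ (m - 1) := one_le_pow₀ hw
  have h4 : ‖v‖ ≤ ‖v‖ * ‖w‖ ^ (m - 1) := le_mul_of_one_le_right (norm_nonneg _) h3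
  by_contra! hlt
  nlinarith

/-! ### The depressed equation and its derivative -/

section Centered

variable {n m : ℕ} {F : (Fin n → ℂ) → ℂ} {c : ℕ → MvPolynomial (Fin n) ℂ}
  {B p : MvPolynomial (Fin n) ℂ}

open MvPolynomial in
/-- The differentiated equation, solved for the part that is transcendental in `F`. -/
theorem centered_deriv_identity (hF : Differentiable ℂ F) (hm : 1 ≤ m) (i : Fin n)
    (h : ∀ z, F z ^ m + ∑ k ∈ Finset.range (m - 1), eval z (c k) * F z ^ k =
      eval z B * Complex.exp (eval z p)) (z : Fin n → ℂ) :
    (m * F z ^ (m - 1) + ∑ k ∈ Finset.range (m - 1), (k * eval z (c k)) * F z ^ (k - 1)) *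
      (m * eval z B * fderiv ℂ F z (Pi.single i 1) -
        eval z (B * pderiv i p + pderiv i B) * F z) =
      ∑ k ∈ Finset.range (m - 1), eval z (C ((m : ℂ) - k) * ((B * pderiv i p + pderiv i B) * c k) -
        C (m : ℂ) * (B * pderiv i (c k))) * F z ^ k := by
  set D := fderiv ℂ F z (Pi.single i 1) with hD
  have dF : HasDerivAt (fun t : ℂ => F (z + t • Pi.single i 1)) D 0 := by
    simpa using hasDerivAt_line hF z (Pi.single i 1) 0
  have dq : ∀ q : MvPolynomial (Fin n) ℂ,
      HasDerivAt (fun t : ℂ => eval (z + t • Pi.single i 1) q) (eval z (pderiv i q)) 0 := by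
    intro q
    have := hasDerivAt_line (differentiable_eval q) z (Pi.single i 1) 0
    rwa [fderiv_eval_single, zero_smul, add_zero] at this
  have hl := (dF.fun_pow m).fun_add (HasDerivAt.fun_sum (u := Finset.range (m - 1)) fun k _ =>
    (dq (c k)).fun_mul (dF.fun_pow k))
  have hr := (dq B).fun_mul (dq p).cexp
  have heq := hl.unique (by simpa only [h] using hr)
  simp only [zero_smul, add_zero] at heq
  have hz := h z
  set E := Complex.exp (eval z p)
  have e1 : ∑ k ∈ Finset.range (m - 1), (eval z (pderiv i (c k)) * F z ^ k +
      eval z (c k) * (k * F z ^ (k - 1) * D)) =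
      ∑ k ∈ Finset.range (m - 1), eval z (pderiv i (c k)) * F z ^ k +
        (∑ k ∈ Finset.range (m - 1), (k * eval z (c k)) * F z ^ (k - 1)) * D := by
    rw [Finset.sum_add_distrib, Finset.sum_mul]
    congr 1
    exact Finset.sum_congr rfl fun k _ => by ring
  have e2 : (∑ k ∈ Finset.range (m - 1), (k * eval z (c k)) * F z ^ (k - 1)) * F z =
      ∑ k ∈ Finset.range (m - 1), (k * eval z (c k)) * F z ^ k := by
    rw [Finset.sum_mul]
    refine Finset.sum_congr rfl fun k _ => ?_
    rcases k with _ | k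
    · simp
    · rw [Nat.add_sub_cancel]
      ring
  have e3 : ∑ k ∈ Finset.range (m - 1), eval z (C ((m : ℂ) - k) *
      ((B * pderiv i p + pderiv i B) * c k) - C (m : ℂ) * (B * pderiv i (c k))) * F z ^ k =
      m * eval z (B * pderiv i p + pderiv i B) *
        ∑ k ∈ Finset.range (m - 1), eval z (c k) * F z ^ k -
      eval z (B * pderiv i p + pderiv i B) *
        ∑ k ∈ Finset.range (m - 1), (k * eval z (c k)) * F z ^ k -
      m * eval z B * ∑ k ∈ Finset.range (m - 1), eval z (pderiv i (c k)) * F z ^ k := by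
    simp only [Finset.mul_sum, ← Finset.sum_sub_distrib]
    refine Finset.sum_congr rfl fun k _ => ?_
    simp only [map_sub, map_mul, map_add, eval_C]
    ring
  have e4 : F z ^ (m - 1) * F z = F z ^ m := by rw [← pow_succ, Nat.sub_add_cancel hm]
  rw [e1] at heq
  rw [e3, ← e2]
  simp only [map_add, map_mul]
  -- The derivative times mB, minus the equation times m(B ∂p + ∂B), cancels the exponential.
  linear_combination (m * eval z B) * heq
    - (m * (eval z B * eval z (pderiv i p) + eval z (pderiv i B))) * hz
    - (m * (eval z B * eval z (pderiv i p) + eval z (pderiv i B))) * e4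

-- Compare degrees in F where |F| ≥ Θ; where |F| < Θ, use Cauchy's estimate on a disc of radius
-- comparable to |B(z)| up to polynomial factors. The extra factor B absorbs the inverse of that
-- radius.
open MvPolynomial in
theorem centered_polyBounded (hF : Differentiable ℂ F) (hm : 1 ≤ m) (i : Fin n)
    (h : ∀ z, F z ^ m + ∑ k ∈ Finset.range (m - 1), eval z (c k) * F z ^ k =
      eval z B * Complex.exp (eval z p)) :
    PolyBounded fun z => ‖eval z B * (m * eval z B * fderiv ℂ F z (Pi.single i 1) -
        eval z (B * pderiv i p + pderiv i B) * F z)‖ := by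
  set s := B * pderiv i p + pderiv i B
  set ψ : ℕ → MvPolynomial (Fin n) ℂ := fun k =>
    C ((m : ℂ) - k) * (s * c k) - C (m : ℂ) * (B * pderiv i (c k))
  obtain ⟨b, hbz'⟩ : ∃ b : (Fin n → ℂ) → ℝ, b = fun z => ‖eval z B‖ := ⟨_, rfl⟩
  obtain ⟨U, hUz'⟩ : ∃ U : (Fin n → ℂ) → ℝ,
    U = fun z => ∑ k ∈ Finset.range (m - 1), ‖eval z (ψ k)‖ := ⟨_, rfl⟩
  obtain ⟨V, hVz'⟩ : ∃ V : (Fin n → ℂ) → ℝ,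
    V = fun z => ∑ k ∈ Finset.range (m - 1), ‖eval z (C (k : ℂ) * c k)‖ := ⟨_, rfl⟩
  obtain ⟨K, hKz'⟩ : ∃ K : (Fin n → ℂ) → ℝ,
    K = fun z => ∑ k ∈ Finset.range (m - 1), ‖eval z (c k)‖ := ⟨_, rfl⟩
  -- Above this threshold the lower terms of Φ_w(F) are at most half of |F|^(m-1). W below bounds
  -- Φ(F), hence B e^p, under the threshold.
  obtain ⟨Θ, hΘz'⟩ : ∃ Θ : (Fin n → ℂ) → ℝ, Θ = fun z => 1 + 2 * V z := ⟨_, rfl⟩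
  obtain ⟨W, hWz'⟩ : ∃ W : (Fin n → ℂ) → ℝ,
    W = fun z => Θ z ^ m + ∑ k ∈ Finset.range (m - 1), ‖eval z (c k)‖ * Θ z ^ k := ⟨_, rfl⟩
  have hb : PolyBounded b := hbz' ▸ .eval B
  have hU : PolyBounded U := hUz' ▸ .sum _ fun k _ => .eval _
  have hV : PolyBounded V := hVz' ▸ .sum _ fun k _ => .eval _
  have hK : PolyBounded K := hKz' ▸ .sum _ fun k _ => .eval _
  have hb0 : ∀ z, 0 ≤ b z := fun z => hbz' ▸ norm_nonneg _
  have hU0 : ∀ z, 0 ≤ U z := fun z => hUz' ▸ Finset.sum_nonneg fun _ _ => norm_nonneg _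
  have hV0 : ∀ z, 0 ≤ V z := fun z => hVz' ▸ Finset.sum_nonneg fun _ _ => norm_nonneg _
  have hΘ1 : ∀ z, Θ z = 1 + 2 * V z := fun z => congrFun hΘz' z
  have hΘ0 : ∀ z, 0 ≤ Θ z := fun z => by linarith [hV0 z, hΘ1 z]
  have hΘ : PolyBounded Θ := hΘz' ▸ (PolyBounded.const 1).add ((PolyBounded.const 2).mul hV hV0)
  have hW : PolyBounded W := hWz' ▸ (hΘ.pow hΘ0 m).add (.sum _ fun k _ =>
    (PolyBounded.eval (c k)).mul (hΘ.pow hΘ0 k) fun z => pow_nonneg (hΘ0 z) k)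
  have hW0 : ∀ z, 0 ≤ W z := fun z => hWz' ▸ add_nonneg (pow_nonneg (hΘ0 z) m)
    (Finset.sum_nonneg fun k _ => mul_nonneg (norm_nonneg _) (pow_nonneg (hΘ0 z) k))
  obtain ⟨K', hK', hK'0, hKK'⟩ := hK.exists_ball 1
  obtain ⟨Y₁, hY₁, hY₁0, hBY⟩ := exists_norm_eval_sub_le B i
  obtain ⟨Y₂, hY₂, hY₂0, hpY⟩ := exists_norm_eval_sub_le p i
  obtain ⟨Y, hYz'⟩ : ∃ Y : (Fin n → ℂ) → ℝ, Y = fun z => Y₁ z + Y₂ z + 1 := ⟨_, rfl⟩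
  obtain ⟨X, hXz'⟩ : ∃ X : (Fin n → ℂ) → ℝ, X = fun z => 1 + K' z + 6 * W z := ⟨_, rfl⟩
  have hYeq : ∀ z, Y z = Y₁ z + Y₂ z + 1 := fun z => congrFun hYz' z
  have hXeq : ∀ z, X z = 1 + K' z + 6 * W z := fun z => congrFun hXz' z
  have hY : PolyBounded Y := hYz' ▸ (hY₁.add hY₂).add (.const 1)
  have hY1 : ∀ z, 1 ≤ Y z := fun z => by linarith [hYeq z, hY₁0 z, hY₂0 z]
  have hX : PolyBounded X := hXz' ▸ ((PolyBounded.const 1).add hK').add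
    ((PolyBounded.const 6).mul hW hW0)
  have hX0 : ∀ z, 0 ≤ X z := fun z => by linarith [hXeq z, hK'0 z, hW0 z]
  have hH : PolyBounded fun z => 2 * U z * b z +
      (m * (X z * (Y z * (1 + b z))) * b z + ‖eval z s‖ * Θ z * b z) := by
    have h1 : PolyBounded fun z => 2 * U z * b z :=
      ((PolyBounded.const 2).mul hU hU0).mul hb hb0
    have h2 : PolyBounded fun z => Y z * (1 + b z) :=
      hY.mul ((PolyBounded.const 1).add hb) fun z => by linarith [hb0 z]
    have h20 : ∀ z, 0 ≤ Y z * (1 + b z) := fun z =>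
      mul_nonneg (by linarith [hY1 z]) (by linarith [hb0 z])
    have h3 : PolyBounded fun z => X z * (Y z * (1 + b z)) := hX.mul h2 h20
    have h4 : PolyBounded fun z => m * (X z * (Y z * (1 + b z))) :=
      (PolyBounded.const (m : ℝ)).mul h3 fun z => mul_nonneg (hX0 z) (h20 z)
    have h5 : PolyBounded fun z => ‖eval z s‖ * Θ z := (PolyBounded.eval s).mul hΘ hΘ0
    exact h1.add ((h4.mul hb hb0).add (h5.mul hb hb0))
  refine hH.mono fun z => ?_
  set G := (m : ℂ) * eval z B * fderiv ℂ F z (Pi.single i 1) - eval z s * F z with hG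
  have hbz := hb0 z
  have hUz := hU0 z
  have hVz := hV0 z
  have hXz := hX0 z
  have hYz := hY1 z
  have hΘz0 := hΘ0 z
  have hWz := hW0 z
  have hn1 : 0 ≤ 2 * U z * b z := by positivity
  have hn2 : 0 ≤ m * (X z * (Y z * (1 + b z))) * b z := by positivity
  have hn3 : 0 ≤ ‖eval z s‖ * Θ z * b z := by positivity
  have hbnorm : ‖eval z B‖ = b z := (congrFun hbz' z).symm
  have hΘz := hΘ1 z
  have hXe := hXeq z
  have hYe := hYeq z
  rw [norm_mul, hbnorm]
  rcases le_or_gt (Θ z) ‖F z‖ with hbig | hsmall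
  · have hF1 : 1 ≤ ‖F z‖ := by linarith
    have hid := centered_deriv_identity hF hm i h z
    have hmono : ∀ k ∈ Finset.range (m - 1), ‖F z‖ ^ k ≤ ‖F z‖ ^ (m - 1) := fun k hk =>
      pow_le_pow_right₀ hF1 (Finset.mem_range.mp hk).le
    set S := ∑ k ∈ Finset.range (m - 1), (k * eval z (c k)) * F z ^ (k - 1) with hS
    have hSF : ‖S‖ * ‖F z‖ ≤ V z * ‖F z‖ ^ (m - 1) := by
      simp only [hVz']
      rw [← norm_mul, hS, Finset.sum_mul, Finset.sum_mul]
      refine norm_sum_le_of_le _ fun k hk => ?_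
      rcases k with _ | k
      · simp
      · rw [Nat.add_sub_cancel, mul_assoc, ← pow_succ, norm_mul, norm_pow, map_mul, eval_C]
        exact mul_le_mul_of_nonneg_left (hmono _ hk) (norm_nonneg _)
    have hpos : 0 < ‖F z‖ ^ (m - 1) := by positivity
    have hS2 : ‖S‖ ≤ ‖F z‖ ^ (m - 1) / 2 := by
      by_contra! hlt
      have h1 : V z ≤ ‖F z‖ / 2 := by linarith
      nlinarith
    have hm' : (1 : ℝ) ≤ m := by exact_mod_cast hm
    have hlow : ‖F z‖ ^ (m - 1) / 2 ≤ ‖(m : ℂ) * F z ^ (m - 1) + S‖ := by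
      have h1 := norm_sub_le_norm_add ((m : ℂ) * F z ^ (m - 1)) S
      rw [norm_mul, norm_pow, Complex.norm_natCast] at h1
      nlinarith
    have hup : ‖∑ k ∈ Finset.range (m - 1), eval z (ψ k) * F z ^ k‖ ≤
        U z * ‖F z‖ ^ (m - 1) := by
      simp only [hUz']
      rw [Finset.sum_mul]
      refine norm_sum_le_of_le _ fun k hk => ?_
      rw [norm_mul, norm_pow]
      exact mul_le_mul_of_nonneg_left (hmono _ hk) (norm_nonneg _)
    rw [← hid, norm_mul] at hup
    have hGU : ‖G‖ ≤ 2 * U z := by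
      have h1 := mul_le_mul_of_nonneg_right hlow (norm_nonneg G)
      have h2 := h1.trans hup
      by_contra! hlt
      nlinarith
    nlinarith
  · rcases eq_or_ne (b z) 0 with h0 | h0
    · rw [h0, zero_mul]
      rw [h0] at hn1 hn2 hn3
      linarith
    have hbpos : 0 < b z := lt_of_le_of_ne hbz (Ne.symm h0)
    have hWle : ‖eval z B * Complex.exp (eval z p)‖ ≤ W z := by
      simp only [hWz']
      rw [← h]
      refine (norm_add_le _ _).trans (add_le_add ?_ (norm_sum_le_of_le _ fun k _ => ?_))
      · rw [norm_pow]
        gcongr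
      · rw [norm_mul, norm_pow]
        gcongr
    -- Chosen so that Yδ ≤ min(|B(z)|, 1): on the circle |B| at most doubles and Re p rises by at
    -- most 1, so |B e^p| grows by at most 2 · 3 = 6.
    set δ := b z / (Y z * (1 + b z)) with hδ
    have hδ0 : 0 < δ := by positivity
    have hYδ : Y z * δ = b z / (1 + b z) := by rw [hδ]; field_simp
    have hYδb : Y z * δ ≤ b z := by
      rw [hYδ]
      exact div_le_self hbz (by linarith)
    have hYδ1 : Y z * δ ≤ 1 := by
      rw [hYδ, div_le_one (by positivity)]
      linarith
    have hδ1 : δ ≤ 1 := by nlinarith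
    have hcirc : ∀ t : ℂ, ‖t‖ = δ → ‖F (z + t • Pi.single i 1)‖ ≤ X z := by
      intro t ht
      have ht1 : ‖t‖ ≤ 1 := ht.trans_le hδ1
      set w := z + t • (Pi.single i 1 : Fin n → ℂ) with hw
      have hnear : ‖w‖ ≤ ‖z‖ + 1 := by
        refine (norm_add_le _ _).trans ?_
        rw [norm_smul]
        gcongr
        exact mul_le_one₀ ht1 (norm_nonneg _) (norm_single_one_le i)
      have hB2 : ‖eval w B‖ ≤ 2 * b z := by
        have h1 := hBY z t ht1
        have h2 := norm_le_norm_add_norm_sub' (eval w B) (eval z B)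
        rw [ht] at h1
        have h3 : Y₁ z * δ ≤ Y z * δ :=
          mul_le_mul_of_nonneg_right (by linarith [hY₂0 z]) hδ0.le
        rw [hbnorm] at h2
        linarith
      have hp2 : ‖Complex.exp (eval w p)‖ ≤ 3 * ‖Complex.exp (eval z p)‖ := by
        have h1 := hpY z t ht1
        rw [ht] at h1
        have h3 : Y₂ z * δ ≤ Y z * δ :=
          mul_le_mul_of_nonneg_right (by linarith [hY₁0 z]) hδ0.le
        have h4 := Complex.re_le_norm (eval w p - eval z p)
        rw [Complex.sub_re] at h4
        have h5 : (eval w p).re ≤ 1 + (eval z p).re := by linarith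
        rw [Complex.norm_exp, Complex.norm_exp]
        refine (Real.exp_le_exp.mpr h5).trans ?_
        rw [Real.exp_add]
        have := Real.exp_one_lt_d9
        gcongr
        linarith
      have h1 := norm_le_of_monic_eq hm (h w)
      have h2 : K w ≤ K' z := hKK' z w hnear
      have h3 : ‖eval w B * Complex.exp (eval w p)‖ ≤ 6 * W z := by
        rw [norm_mul, hbnorm] at hWle
        rw [norm_mul]
        calc ‖eval w B‖ * ‖Complex.exp (eval w p)‖
            ≤ (2 * b z) * (3 * ‖Complex.exp (eval z p)‖) := by gcongr
          _ = 6 * (b z * ‖Complex.exp (eval z p)‖) := by ring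
          _ ≤ 6 * W z := by gcongr
      have h4 : K w = ∑ k ∈ Finset.range (m - 1), ‖eval w (c k)‖ := congrFun hKz' w
      linarith
    have hD := norm_fderiv_apply_le hF z (Pi.single i 1) hδ0 hcirc
    have hD' : b z * ‖fderiv ℂ F z (Pi.single i 1)‖ ≤ X z * (Y z * (1 + b z)) := by
      refine (mul_le_mul_of_nonneg_left hD hbz).trans (le_of_eq ?_)
      rw [hδ]
      field_simp
    have hGle : ‖G‖ ≤ m * (X z * (Y z * (1 + b z))) + ‖eval z s‖ * Θ z := by
      refine (norm_sub_le _ _).trans ?_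
      rw [norm_mul, norm_mul, norm_mul, Complex.norm_natCast, hbnorm, mul_assoc]
      exact add_le_add (mul_le_mul_of_nonneg_left hD' (Nat.cast_nonneg m))
        (mul_le_mul_of_nonneg_left hsmall.le (norm_nonneg _))
    have := mul_le_mul_of_nonneg_left hGle hbz
    linarith

end Centered

/-! ### Algebraic consequences of transcendence -/

section Algebra

variable {n : ℕ}

/-- Evaluation of entire functions at a point. -/
def Entire.evalHom (z : Fin n → ℂ) : Entire n →+* ℂ :=
  (Pi.evalRingHom (fun _ : Fin n → ℂ => ℂ) z).comp (Entire n).val.toRingHom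

theorem Entire.aeval_apply (F : Entire n) (T : Polynomial (MvPolynomial (Fin n) ℂ))
    (z : Fin n → ℂ) :
    (Polynomial.aeval F T : Entire n) z = T.eval₂ (MvPolynomial.eval z) (F z) := by
  have h := Polynomial.hom_eval₂ T (algebraMap (MvPolynomial (Fin n) ℂ) (Entire n))
    (Entire.evalHom z) F
  rw [show (Entire.evalHom z).comp (algebraMap (MvPolynomial (Fin n) ℂ) (Entire n)) =
    MvPolynomial.eval z from RingHom.ext fun q => Entire.algebraMap_apply q z] at h
  exact h

theorem Entire.eq_zero_of_eval₂ {F : Entire n} (hF : Transcendental (MvPolynomial (Fin n) ℂ) F)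
    {T : Polynomial (MvPolynomial (Fin n) ℂ)}
    (h : ∀ z, T.eval₂ (MvPolynomial.eval z) (F z) = 0) : T = 0 := by
  refine (transcendental_iff.mp hF) T (Subtype.ext (funext fun z => ?_))
  exact (Entire.aeval_apply F T z).trans (h z)

/-- The centered form of the main algebraic statement: no lower order terms are possible. -/
theorem centered_coeff_eq_zero {m : ℕ} {F : Entire n}
    (hFt : Transcendental (MvPolynomial (Fin n) ℂ) F) {c : ℕ → MvPolynomial (Fin n) ℂ}
    {B p : MvPolynomial (Fin n) ℂ} (hm : 1 ≤ m) (hB : B ≠ 0) {i : Fin n}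
    (hp : MvPolynomial.pderiv i p ≠ 0)
    (h : ∀ z, F z ^ m + ∑ k ∈ Finset.range (m - 1), MvPolynomial.eval z (c k) * F z ^ k =
      MvPolynomial.eval z B * Complex.exp (MvPolynomial.eval z p)) :
    ∀ k ∈ Finset.range (m - 1), c k = 0 := by
  have hm0 : (m : ℂ) ≠ 0 := by exact_mod_cast (by omega : m ≠ 0)
  obtain ⟨Q, hQ⟩ := exists_mvPolynomial_of_polyBounded (fun z j =>
    (differentiable_update (differentiable_eval B) z j).fun_mul
      ((((differentiable_const (m : ℂ)).fun_mul
        (differentiable_update (differentiable_eval B) z j)).fun_mul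
          (differentiable_fderiv_update F.2 (Pi.single i 1) z j)).fun_sub
        ((differentiable_update (differentiable_eval _) z j).fun_mul
          (differentiable_update F.2 z j))))
    (centered_polyBounded F.2 hm i h)
  set s := B * MvPolynomial.pderiv i p + MvPolynomial.pderiv i B with hs
  set ψ : ℕ → MvPolynomial (Fin n) ℂ := fun k => MvPolynomial.C ((m : ℂ) - k) * (s * c k) -
    MvPolynomial.C (m : ℂ) * (B * MvPolynomial.pderiv i (c k)) with hψ
  -- The differentiated identity times B, read as a polynomial relation for F.
  have hT : (Polynomial.C (MvPolynomial.C (m : ℂ) * Q) * Polynomial.X ^ (m - 1) +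
      ∑ k ∈ Finset.range (m - 1),
        Polynomial.C (MvPolynomial.C (k : ℂ) * c k * Q) * Polynomial.X ^ (k - 1)) -
      ∑ k ∈ Finset.range (m - 1), Polynomial.C (B * ψ k) * Polynomial.X ^ k = 0 := by
    refine Entire.eq_zero_of_eval₂ hFt fun z => ?_
    have hid := centered_deriv_identity F.2 hm i h z
    have hQz := hQ z
    have e1 : ∑ k ∈ Finset.range (m - 1),
        (k : ℂ) * MvPolynomial.eval z (c k) * MvPolynomial.eval z Q * F z ^ (k - 1) =
        MvPolynomial.eval z Q * ∑ k ∈ Finset.range (m - 1),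
          (k * MvPolynomial.eval z (c k)) * F z ^ (k - 1) := by
      rw [Finset.mul_sum]
      exact Finset.sum_congr rfl fun k _ => by ring
    have e2 : ∑ k ∈ Finset.range (m - 1),
        MvPolynomial.eval z B * MvPolynomial.eval z (ψ k) * F z ^ k =
        MvPolynomial.eval z B * ∑ k ∈ Finset.range (m - 1),
          MvPolynomial.eval z (ψ k) * F z ^ k := by
      rw [Finset.mul_sum]
      exact Finset.sum_congr rfl fun k _ => by ring
    simp only [Polynomial.eval₂_sub, Polynomial.eval₂_add, Polynomial.eval₂_finsetSum,
      Polynomial.eval₂_mul, Polynomial.eval₂_pow, Polynomial.eval₂_C, Polynomial.eval₂_X, map_mul,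
      MvPolynomial.eval_C]
    rw [e1, e2, ← hid, ← hQz]
    ring
  -- Only the leading term m Q w^(m-1) reaches degree m-1.
  have hQ0 : Q = 0 := by
    have := congrArg (fun T => T.coeff (m - 1)) hT
    simp only [Polynomial.coeff_sub, Polynomial.coeff_add, Polynomial.finsetSum_coeff,
      Polynomial.coeff_C_mul_X_pow, Polynomial.coeff_zero] at this
    rw [Finset.sum_eq_zero fun k hk => if_neg (by have := Finset.mem_range.mp hk; omega),
      Finset.sum_eq_zero fun k hk => if_neg (by have := Finset.mem_range.mp hk; omega)] at this
    simpa [show m ≠ 0 by omega] using this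
  intro k hk
  have hψk : ψ k = 0 := by
    have := congrArg (fun T => T.coeff k) hT
    simp only [hQ0, mul_zero, Polynomial.C_0, zero_mul, Finset.sum_const_zero, add_zero, zero_sub,
      Polynomial.coeff_neg, Polynomial.finsetSum_coeff, Polynomial.coeff_C_mul_X_pow,
      Polynomial.coeff_zero, neg_eq_zero] at this
    rw [Finset.sum_ite_eq, if_pos hk] at this
    exact (mul_eq_zero.mp this).resolve_left hB
  by_contra hck
  have hmk : (m : ℂ) - k ≠ 0 := by
    rw [sub_ne_zero]
    have := Finset.mem_range.mp hk
    exact_mod_cast (by omega : m ≠ k)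
  refine hp (pderiv_eq_zero_of_logDeriv (a := m) (b := m - k) (c := m - k) hck hB hmk ?_)
  simp only [hψ, hs] at hψk
  linear_combination hψk

/-- A polynomial is not the product of a polynomial and the exponential of a nonconstant one. -/
theorem eval_ne_eval_mul_exp {A B p : MvPolynomial (Fin n) ℂ} (hB : B ≠ 0) {i : Fin n}
    (hp : MvPolynomial.pderiv i p ≠ 0) :
    ¬ ∀ z, MvPolynomial.eval z A = MvPolynomial.eval z B * Complex.exp (MvPolynomial.eval z p) := by
  intro h
  have hA : A ≠ 0 := by
    rintro rfl
    refine hB (MvPolynomial.funext fun z => ?_)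
    simpa using h z
  refine hp (pderiv_eq_zero_of_logDeriv (a := 1) (b := 1) (c := 1) hA hB one_ne_zero
    (MvPolynomial.funext fun z => ?_))
  have dq : ∀ q : MvPolynomial (Fin n) ℂ, HasDerivAt
      (fun t : ℂ => MvPolynomial.eval (z + t • Pi.single i 1) q)
      (MvPolynomial.eval z (MvPolynomial.pderiv i q)) 0 := by
    intro q
    have := hasDerivAt_line (differentiable_eval q) z (Pi.single i 1) 0
    rwa [fderiv_eval_single, zero_smul, add_zero] at this
  have heq := (dq A).unique (by simpa only [h] using (dq B).fun_mul (dq p).cexp)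
  simp only [zero_smul, add_zero] at heq
  have hz := h z
  simp only [map_mul, map_sub, map_one, one_mul]
  linear_combination (MvPolynomial.eval z B * MvPolynomial.eval z (MvPolynomial.pderiv i p) +
    MvPolynomial.eval z (MvPolynomial.pderiv i B)) * hz - MvPolynomial.eval z B * heq

/-- An entire `m`-th root of `B e ^ p` is a polynomial times `e ^ (p / m)`. -/
theorem exists_root_of_pow_eq {m : ℕ} (hm : 1 ≤ m) {F : (Fin n → ℂ) → ℂ}
    (hF : Differentiable ℂ F) {B p : MvPolynomial (Fin n) ℂ}
    (h : ∀ z, F z ^ m = MvPolynomial.eval z B * Complex.exp (MvPolynomial.eval z p)) :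
    ∃ q : MvPolynomial (Fin n) ℂ, q ^ m = B ∧
      ∀ z, F z = MvPolynomial.eval z q * Complex.exp ((m : ℂ)⁻¹ * MvPolynomial.eval z p) := by
  have hm0 : (m : ℂ) ≠ 0 := by exact_mod_cast (by omega : m ≠ 0)
  -- g^m = B, so |g| ≤ 1 + |B|.
  let g : (Fin n → ℂ) → ℂ := fun z => F z * Complex.exp (-((m : ℂ)⁻¹ * MvPolynomial.eval z p))
  have hg : Differentiable ℂ g :=
    hF.fun_mul ((differentiable_eval p).const_mul _).fun_neg.cexp
  have hgm : ∀ z, g z ^ m = MvPolynomial.eval z B := fun z => by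
    simp only [g]
    rw [mul_pow, h, ← Complex.exp_nat_mul, mul_assoc, ← Complex.exp_add]
    have : MvPolynomial.eval z p + m * -((m : ℂ)⁻¹ * MvPolynomial.eval z p) = 0 := by
      field_simp
      ring
    rw [this, Complex.exp_zero, mul_one]
  obtain ⟨q, hq⟩ := exists_mvPolynomial_of_polyBounded (fun z i => differentiable_update hg z i)
    (((PolyBounded.const 1).add (PolyBounded.eval B)).mono fun z => by
      rw [← hgm, norm_pow]
      rcases le_total ‖g z‖ 1 with h1 | h1
      · linarith [pow_nonneg (norm_nonneg (g z)) m]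
      · linarith [le_self_pow₀ h1 (by omega : m ≠ 0)])
  refine ⟨q, MvPolynomial.funext fun z => ?_, fun z => ?_⟩
  · rw [map_pow, ← hq, hgm]
  · rw [← hq]
    simp only [g]
    rw [mul_assoc, ← Complex.exp_add, neg_add_cancel, Complex.exp_zero, mul_one]

/-- The depressed form of a monic polynomial has no term of second highest degree. -/
theorem coeff_taylor_of_monic {S : Type*} [CommRing S] [Nontrivial S] {Q : Polynomial S}
    (hQ : Q.Monic) (hm : 1 ≤ Q.natDegree) {r : S}
    (hr : (Q.natDegree : S) * r = -Q.coeff (Q.natDegree - 1)) :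
    (Polynomial.taylor r Q).coeff (Q.natDegree - 1) = 0 := by
  set m := Q.natDegree with hmdef
  rw [Polynomial.taylor_coeff]
  have hdeg : (Polynomial.hasseDeriv (m - 1) Q).natDegree ≤ 1 :=
    (Polynomial.natDegree_hasseDeriv_le _ _).trans (by omega)
  -- The Hasse derivative of order m-1 is the linear polynomial Q_{m-1} + m w.
  rw [Polynomial.eval_eq_sum_range' (Nat.lt_succ_of_le hdeg)]
  have h1 : 1 + (m - 1) = m := by omega
  have hlead : Q.coeff m = 1 := hQ.coeff_natDegree
  simp only [Finset.sum_range_succ, Finset.sum_range_zero, Polynomial.hasseDeriv_coeff, zero_add,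
    pow_zero, pow_one, h1, Nat.choose_self, hlead, Nat.cast_one, mul_one, one_mul]
  rw [Nat.choose_symm_of_eq_add (by omega : m = (m - 1) + 1), Nat.choose_one_right, hr]
  ring

/-- The polynomial form of the theorem: a polynomial in a transcendental entire function which is
a polynomial multiple of `e ^ p` is a multiple of the power of a linear polynomial. -/
theorem eval₂_eq_mul_exp_structure {f : Entire n}
    (hf : Transcendental (MvPolynomial (Fin n) ℂ) f) {A : Polynomial (MvPolynomial (Fin n) ℂ)}
    {B p : MvPolynomial (Fin n) ℂ} (hB : B ≠ 0) {i : Fin n} (hp : MvPolynomial.pderiv i p ≠ 0)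
    (h : ∀ z, A.eval₂ (MvPolynomial.eval z) (f z) =
      MvPolynomial.eval z B * Complex.exp (MvPolynomial.eval z p)) :
    1 ≤ A.natDegree ∧ ∃ q r : MvPolynomial (Fin n) ℂ,
      Polynomial.C (A.leadingCoeff ^ (A.natDegree - 1)) * A =
        (Polynomial.C A.leadingCoeff * Polynomial.X + Polynomial.C r) ^ A.natDegree ∧
      q ^ A.natDegree = A.leadingCoeff ^ (A.natDegree - 1) * B ∧
      ∀ z, MvPolynomial.eval z A.leadingCoeff * f z + MvPolynomial.eval z r =
        MvPolynomial.eval z q *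
          Complex.exp ((A.natDegree : ℂ)⁻¹ * MvPolynomial.eval z p) := by
  have hm : 1 ≤ A.natDegree := by
    by_contra! hlt
    obtain ⟨a, rfl⟩ := Polynomial.natDegree_eq_zero.mp (by omega : A.natDegree = 0)
    exact eval_ne_eval_mul_exp (A := a) hB hp fun z => by simpa using h z
  refine ⟨hm, ?_⟩
  set m := A.natDegree with hmdef
  set a := A.leadingCoeff with ha
  have hA0 : A ≠ 0 := by
    rintro rfl
    simp [hmdef] at hm
  have ha0 : a ≠ 0 := Polynomial.leadingCoeff_ne_zero.mpr hA0
  have hm0 : (m : ℂ) ≠ 0 := by exact_mod_cast (by omega : m ≠ 0)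
  -- Q(a w) = a^(m-1) A(w): monic, with coefficients still polynomial.
  set Q := A.integralNormalization with hQdef
  have hQ : Q.Monic := Polynomial.monic_integralNormalization hA0
  have hQm : Q.natDegree = m := Polynomial.natDegree_integralNormalization
  set r : MvPolynomial (Fin n) ℂ := MvPolynomial.C (m : ℂ)⁻¹ * Q.coeff (m - 1) with hr
  have hmr : (m : MvPolynomial (Fin n) ℂ) * -r = -Q.coeff (m - 1) := by
    rw [hr, mul_neg, ← mul_assoc, ← map_natCast (MvPolynomial.C (σ := Fin n) (R := ℂ)), ← map_mul,
      mul_inv_cancel₀ hm0, map_one, one_mul]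
  set Φ := Polynomial.taylor (-r) Q with hΦ
  have hΦ1 : Φ.coeff (m - 1) = 0 := by
    have := coeff_taylor_of_monic hQ (by omega) (r := -r) (by rw [hQm]; exact hmr)
    rwa [hQm] at this
  have hΦm : Φ.natDegree = m := by rw [hΦ, Polynomial.natDegree_taylor, hQm]
  have hΦmonic : Φ.Monic := by
    rw [Polynomial.Monic, hΦ, Polynomial.leadingCoeff_taylor]
    exact hQ
  have hΦsum : Φ = Polynomial.X ^ m +
      ∑ k ∈ Finset.range (m - 1), Polynomial.C (Φ.coeff k) * Polynomial.X ^ k := by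
    conv_lhs => rw [hΦmonic.as_sum, hΦm, (by omega : m = (m - 1) + 1), Finset.sum_range_succ, hΦ1]
    rw [Nat.sub_add_cancel hm]
    simp
  let F : Entire n := algebraMap (MvPolynomial (Fin n) ℂ) (Entire n) a * f +
    algebraMap (MvPolynomial (Fin n) ℂ) (Entire n) r
  have hFz : ∀ z, F z = MvPolynomial.eval z a * f z + MvPolynomial.eval z r := fun z => by
    rw [← Entire.algebraMap_apply, ← Entire.algebraMap_apply]
    rfl
  have hFt : Transcendental (MvPolynomial (Fin n) ℂ) F := by
    rw [transcendental_iff]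
    intro T hT
    have hcomp : T.comp (Polynomial.C a * Polynomial.X + Polynomial.C r) = 0 := by
      refine (transcendental_iff.mp hf) _ ?_
      rw [Polynomial.aeval_comp]
      simpa [F] using hT
    rcases Polynomial.comp_eq_zero_iff.mp hcomp with h0 | ⟨-, h0⟩
    · exact h0
    · have := congrArg (fun T => T.coeff 1) h0
      simp [ha0] at this
  have hFeq : ∀ z, F z ^ m + ∑ k ∈ Finset.range (m - 1),
      MvPolynomial.eval z (Φ.coeff k) * F z ^ k =
      MvPolynomial.eval z (a ^ (m - 1) * B) * Complex.exp (MvPolynomial.eval z p) := by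
    intro z
    have h1 : Φ.eval₂ (MvPolynomial.eval z) (F z) =
        Q.eval₂ (MvPolynomial.eval z) (MvPolynomial.eval z a * f z) := by
      rw [hΦ, Polynomial.taylor_apply, Polynomial.eval₂_comp, hFz]
      simp
    rw [Polynomial.integralNormalization_eval₂_leadingCoeff_mul hm, h] at h1
    conv_lhs at h1 => rw [hΦsum]
    simp only [Polynomial.eval₂_add, Polynomial.eval₂_finsetSum, Polynomial.eval₂_mul,
      Polynomial.eval₂_pow, Polynomial.eval₂_C, Polynomial.eval₂_X] at h1
    rw [h1, map_mul, map_pow]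
    ring
  have hB' : a ^ (m - 1) * B ≠ 0 := mul_ne_zero (pow_ne_zero _ ha0) hB
  have hc := centered_coeff_eq_zero hFt hm hB' hp hFeq
  have hΦX : Φ = Polynomial.X ^ m := by
    rw [hΦsum, Finset.sum_eq_zero fun k hk => by rw [hc k hk]; simp, add_zero]
  have hQX : Q = (Polynomial.X + Polynomial.C r) ^ m := by
    have h1 : Polynomial.taylor r Φ = Q := by
      rw [hΦ, Polynomial.taylor_taylor, add_neg_cancel, Polynomial.taylor_zero]
    rw [← h1, hΦX, Polynomial.taylor_apply]
    simp
  obtain ⟨q, hq, hq'⟩ := exists_root_of_pow_eq hm F.2 (B := a ^ (m - 1) * B) (p := p) fun z => by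
    rw [← hFeq z, Finset.sum_eq_zero fun k hk => by rw [hc k hk]; simp, add_zero]
  refine ⟨q, r, ?_, hq, fun z => by rw [← hFz]; exact hq' z⟩
  -- Evaluating at X itself turns the normalization into an identity of polynomials.
  have h1 := Polynomial.integralNormalization_eval₂_leadingCoeff_mul (p := A) hm Polynomial.C
    Polynomial.X
  rw [← hQdef, hQX] at h1
  rw [Polynomial.eval₂_pow, Polynomial.eval₂_add, Polynomial.eval₂_X, Polynomial.eval₂_C,
    Polynomial.eval₂_C_X] at h1
  rw [h1, map_pow]

end Algebra

/-! ### Clearing denominators and the final statement -/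

section Meromorphic

variable {n : ℕ}

/-- Clearing denominators in an identity `P(f) = R e ^ p`. -/
theorem exists_clear_denominators {f p : Entire n} {P : Polynomial (RatFun n)} {R : RatFun n}
    (hR : R ≠ 0)
    (hP : Polynomial.aeval (algebraMap (Entire n) (Mero n) f) P =
      algebraMap (RatFun n) (Mero n) R * algebraMap (Entire n) (Mero n) (Entire.exp p)) :
    ∃ (e B : MvPolynomial (Fin n) ℂ) (A : Polynomial (MvPolynomial (Fin n) ℂ)), e ≠ 0 ∧ B ≠ 0 ∧
      A.map (algebraMap _ (RatFun n)) =
        Polynomial.C (algebraMap (MvPolynomial (Fin n) ℂ) (RatFun n) e) * P ∧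
      algebraMap _ (RatFun n) B = algebraMap (MvPolynomial (Fin n) ℂ) (RatFun n) e * R ∧
      ∀ z, A.eval₂ (MvPolynomial.eval z) (f z) = MvPolynomial.eval z B * Complex.exp (p z) := by
  -- b clears the coefficients of P and d clears R = r/d; the common multiplier is e = b d.
  obtain ⟨b, hbM, hb⟩ := IsLocalization.integerNormalization_spec
    (nonZeroDivisors (MvPolynomial (Fin n) ℂ)) P
  set A₀ := IsLocalization.integerNormalization (nonZeroDivisors (MvPolynomial (Fin n) ℂ)) P
  obtain ⟨r, d, hd, hrd⟩ := IsFractionRing.div_surjective (A := MvPolynomial (Fin n) ℂ) R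
  have hd0 : d ≠ 0 := nonZeroDivisors.ne_zero hd
  have hb0 : b ≠ 0 := nonZeroDivisors.ne_zero hbM
  have hinj := IsFractionRing.injective (MvPolynomial (Fin n) ℂ) (RatFun n)
  have hd0' : algebraMap (MvPolynomial (Fin n) ℂ) (RatFun n) d ≠ 0 :=
    (map_ne_zero_iff _ hinj).mpr hd0
  have hr0 : r ≠ 0 := by
    rintro rfl
    rw [map_zero, zero_div] at hrd
    exact hR hrd.symm
  have hA : (Polynomial.C d * A₀).map (algebraMap _ (RatFun n)) =
      Polynomial.C (algebraMap (MvPolynomial (Fin n) ℂ) (RatFun n) (b * d)) * P := by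
    rw [Polynomial.map_mul, hb, Polynomial.map_C, Algebra.smul_def, map_mul, map_mul,
      Polynomial.algebraMap_apply]
    ring
  have hB : algebraMap _ (RatFun n) (b * r) =
      algebraMap (MvPolynomial (Fin n) ℂ) (RatFun n) (b * d) * R := by
    rw [← hrd, map_mul, map_mul]
    field_simp
  refine ⟨b * d, b * r, Polynomial.C d * A₀, mul_ne_zero hb0 hd0, mul_ne_zero hb0 hr0, hA, hB,
    fun z => ?_⟩
  have key : Polynomial.aeval f (Polynomial.C d * A₀) =
      algebraMap (MvPolynomial (Fin n) ℂ) (Entire n) (b * r) * Entire.exp p := by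
    refine Mero.algebraMap_injective n ?_
    rw [← Polynomial.aeval_algebraMap_apply, ← Polynomial.aeval_map_algebraMap (RatFun n), hA,
      map_mul, hP, Polynomial.aeval_C, ← mul_assoc, ← map_mul, ← hB,
      RingHom.map_mul (algebraMap (Entire n) (Mero n)),
      ← IsScalarTower.algebraMap_apply, ← IsScalarTower.algebraMap_apply]
  rw [← Entire.aeval_apply, key, ← Entire.algebraMap_apply]
  rfl

end Meromorphic

theorem eq_sub_of_mul_add_eq {S : Type*} [CommRing S] {a a' x r q y : S} (h : a' * a = 1)
    (hx : a * x + r = q * y) : x = a' * q * y - a' * r := by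
  linear_combination a' * hx - x * h

theorem theorem4p1 (n : ℕ) (f : Entire n)
    (hf : Transcendental (MvPolynomial (Fin n) ℂ) f) (hord : Entire.FiniteOrder f)
    (P : Polynomial (RatFun n)) (R : RatFun n) (p : Entire n)
    (hR : R ≠ 0) (hp : ¬ ∃ c : ℂ, ∀ z, p z = c)
    (hP : Polynomial.aeval (algebraMap (Entire n) (Mero n) f) P =
      algebraMap (RatFun n) (Mero n) R * algebraMap (Entire n) (Mero n) (Entire.exp p)) :
    (∃ q : MvPolynomial (Fin n) ℂ, 1 ≤ q.totalDegree ∧ ∀ z, p z = MvPolynomial.eval z q) ∧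
    ∃ m : ℕ, 1 ≤ m ∧ ∃ p₁ p₂ : RatFun n, p₂ ≠ 0 ∧
      P = Polynomial.C (R * p₂ ^ m) * (Polynomial.X + Polynomial.C p₁) ^ m ∧
      algebraMap (Entire n) (Mero n) f =
        algebraMap (RatFun n) (Mero n) p₂⁻¹ *
            algebraMap (Entire n) (Mero n) (Entire.exp ((m : ℂ)⁻¹ • p)) -
          algebraMap (RatFun n) (Mero n) p₁ := by
  obtain ⟨e, B, A, he, hB, hA, hBR, hz⟩ := exists_clear_denominators hR hP
  obtain ⟨p', hp'⟩ := exists_mvPolynomial_of_expBounded hB p.2 (by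
    simp only [← hz, Polynomial.eval₂_eq_sum_range]
    exact ExpBounded.sum _ fun k _ => (ExpBounded.eval _).mul (hord.expBounded.pow k))
  have hdeg : 1 ≤ p'.totalDegree := by
    by_contra! hlt
    obtain ⟨c, rfl⟩ : ∃ c, p' = MvPolynomial.C c :=
      ⟨_, MvPolynomial.totalDegree_eq_zero_iff_eq_C.mp (by omega)⟩
    exact hp ⟨c, fun z => by rw [hp', MvPolynomial.eval_C]⟩
  refine ⟨⟨p', hdeg, hp'⟩, ?_⟩
  -- If all partial derivatives vanished, p would be constant.
  obtain ⟨i, hi⟩ : ∃ i, MvPolynomial.pderiv i p' ≠ 0 := by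
    by_contra! h0
    refine hp ⟨p 0, fun z => ?_⟩
    refine is_const_of_fderiv_eq_zero (𝕜 := ℂ) p.2 (fun w => ?_) z 0
    refine ContinuousLinearMap.coe_injective ((Pi.basisFun ℂ (Fin n)).ext fun j => ?_)
    have := fderiv_eval_single p' w j
    rw [h0 j, map_zero, ← funext hp'] at this
    simpa using this
  obtain ⟨hm, q, r, hAr, hq, hfz⟩ := eval₂_eq_mul_exp_structure hf hB hi
    fun z => by rw [hz z, hp']
  set m := A.natDegree
  set a := A.leadingCoeff with ha
  let κ := algebraMap (MvPolynomial (Fin n) ℂ) (RatFun n)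
  have hinj : Function.Injective κ := IsFractionRing.injective _ _
  have ha0 : a ≠ 0 := by
    rw [ha, Polynomial.leadingCoeff_ne_zero]
    rintro rfl
    simp [m] at hm
  have hm0 : m ≠ 0 := by omega
  have hq0 : q ≠ 0 := by
    rintro rfl
    rw [zero_pow hm0] at hq
    exact mul_ne_zero (pow_ne_zero _ ha0) hB hq.symm
  have hκa : κ a ≠ 0 := (map_ne_zero_iff _ hinj).mpr ha0
  have hκq : κ q ≠ 0 := (map_ne_zero_iff _ hinj).mpr hq0
  have hκe : κ e ≠ 0 := (map_ne_zero_iff _ hinj).mpr he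
  have hpow : κ a ^ (m - 1) * κ a = κ a ^ m := by rw [← pow_succ, Nat.sub_add_cancel hm]
  -- Read off from a f + r = q e^{p/m}; the formula for P then uses q^m = a^(m-1) B and B = e R.
  refine ⟨m, hm, κ r / κ a, κ a / κ q, div_ne_zero hκa hκq, ?_, ?_⟩
  · have h1 := congrArg (Polynomial.map κ) hAr
    rw [Polynomial.map_mul, Polynomial.map_pow, Polynomial.map_add, Polynomial.map_mul,
      Polynomial.map_C, Polynomial.map_C, Polynomial.map_C, Polynomial.map_X, hA] at h1
    have h2 : Polynomial.C (κ a) * Polynomial.X + Polynomial.C (κ r) =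
        Polynomial.C (κ a) * (Polynomial.X + Polynomial.C (κ r / κ a)) := by
      rw [mul_add, ← Polynomial.C_mul, mul_div_cancel₀ _ hκa]
    have h3 : κ q ^ m = κ a ^ (m - 1) * (κ e * R) := by
      rw [← map_pow, hq, map_mul, map_pow, hBR]
    have h4 : R * (κ a / κ q) ^ m * (κ a ^ (m - 1) * κ e) = κ a ^ m := by
      rw [div_pow]
      field_simp
      rw [h3]
      ring
    rw [h2, mul_pow, map_pow] at h1
    have h5 : Polynomial.C (κ a ^ (m - 1) * κ e) ≠ 0 :=
      Polynomial.C_ne_zero.mpr (mul_ne_zero (pow_ne_zero _ hκa) hκe)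
    refine mul_left_cancel₀ h5 ?_
    rw [← mul_assoc, ← Polynomial.C_mul, mul_comm _ (R * _), h4, Polynomial.C_pow, ← h1, map_mul,
      map_pow, mul_assoc]
  · have hE : algebraMap (MvPolynomial (Fin n) ℂ) (Entire n) a * f +
        algebraMap (MvPolynomial (Fin n) ℂ) (Entire n) r =
        algebraMap (MvPolynomial (Fin n) ℂ) (Entire n) q * Entire.exp ((m : ℂ)⁻¹ • p) := by
      refine Subtype.ext (funext fun z => ?_)
      have := hfz z
      rw [← hp', ← Entire.algebraMap_apply, ← Entire.algebraMap_apply,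
        ← Entire.algebraMap_apply] at this
      exact this
    have hE' := congrArg (algebraMap (Entire n) (Mero n)) hE
    rw [RingHom.map_add, RingHom.map_mul, RingHom.map_mul, ← IsScalarTower.algebraMap_apply,
      ← IsScalarTower.algebraMap_apply, ← IsScalarTower.algebraMap_apply,
      IsScalarTower.algebraMap_apply _ (RatFun n) (Mero n),
      IsScalarTower.algebraMap_apply _ (RatFun n) (Mero n) r,
      IsScalarTower.algebraMap_apply _ (RatFun n) (Mero n) q] at hE'
    have hunit : algebraMap (RatFun n) (Mero n) (κ a)⁻¹ * algebraMap (RatFun n) (Mero n) (κ a) =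
        1 := by rw [← map_mul, inv_mul_cancel₀ hκa, map_one]
    have h1 : algebraMap (RatFun n) (Mero n) (κ a / κ q)⁻¹ =
        algebraMap (RatFun n) (Mero n) (κ a)⁻¹ * algebraMap (RatFun n) (Mero n) (κ q) := by
      rw [← map_mul, inv_div, div_eq_inv_mul]
    have h2 : algebraMap (RatFun n) (Mero n) (κ r / κ a) =
        algebraMap (RatFun n) (Mero n) (κ a)⁻¹ * algebraMap (RatFun n) (Mero n) (κ r) := by
      rw [← map_mul, div_eq_inv_mul]
    rw [h1, h2]
    exact eq_sub_of_mul_add_eq (S := Mero n) hunit hE'
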